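/- All manifolds are smooth ($C^\infty$, finite-dimensional, Hausdorff, second countable); a distribution is a smooth vector subbundle of the tangent bundle, and $[\mathcal A,\mathcal B]\subseteq\mathcal D$ means that brackets of local sections of $\mathcal A$ and $\mathcal B$ take values in $\mathcal D$. Let $\widetilde{\mathcal S}$ be a manifold with a tuple of distributions $(\widetilde\Delta,\mathcal C,\{\mathcal V_i\}_{i\in\mathbb Z})$ such that * (P1) $\mathcal C$ and all $\mathcal V_i$ are subdistributions of $\widetilde\Delta$; * (P2) $\mathcal C$ is integrable, $[\mathcal C,\mathcal C]\subseteq\mathcal C$, and $[\mathcal C,\widetilde\Delta]\subseteq\widetilde\Delta$; * (P3) $\mathcal V_i\subseteq\mathcal V_{i-1}$ and $[\mathcal C,\mathcal V_i]\subseteq\mathcal V_{i-1}+\mathcal C$ for all $i$, and there are integers $r,s$ and a field of subspaces $\mathcal D$ with $\mathcal V_i+\mathcal C=\mathcal D$ for $i\le r$ and $\mathcal V_i=\mathcal V_s$ for $i\ge s$; * (P4) for every $i$ the dimension of $\mathcal V_i(x)\cap\mathcal C(x)$ does not depend on $x\in\widetilde{\mathcal S}$. Assume that the quotient manifold $\mathcal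 S=\widetilde{\mathcal S}/\mathrm{Fol}(\mathcal C)$ exists, i.e. there is a surjective smooth submersion $\Phi\colon\widetilde{\mathcal S}\to\mathcal S$ with $\ker d\Phi=\mathcal C$ whose fibers are the leaves of the foliation of $\widetilde{\mathcal S}$ by maximal integral submanifolds of $\mathcal C$. The linearization of the tuple consists of the distribution $\Delta=\Phi_*\widetilde\Delta$ on $\mathcal S$ and, for each leaf $\gamma\in\mathcal S$, the set $\mathcal Y^\gamma=\{\mathcal Y^\gamma(x):x\in\gamma\}$ of flags $\mathcal Y^\gamma(x)=\{\Phi_*\mathcal V_i(x)\}_{i\in\mathbb Z}$ in $\Delta(\gamma)\subseteq T_\gamma\mathcal S$. Assume that these sets form submanifolds depending smoothly on $\gamma$, with $\widetilde{\mathcal S}$ as their tautological bundle, i.e. that $x\mapsto(\Phi(x),\mathcal Y^{\Phi(x)}(x))$ is a smooth embedding of $\widetilde{\mathcal S}$ into the bundle of flags in the tangent spaces of $\mathcal S$. Then $(\Delta,\{\mathcal Y^\gamma\}_{\gamma\in\mathcal S})$ is called the flag structure obtained by linearization. **Proposition.** Let $(\widetilde\Delta,\mathcal C,\{\mathcal V_i\})$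 on $\widetilde{\mathcal S}$ and $(\widetilde\Delta^1,\mathcal C^1,\{\mathcal V^1_i\})$ on $\widetilde{\mathcal S}^1$ be two tuples as above, and assume in addition that $\mathcal C\subseteq\mathcal V_i$ and $\mathcal C^1\subseteq\mathcal V_i^1$ for all $i\in\mathbb Z$. 1. The two tuples are equivalent (there is a diffeomorphism $F\colon\widetilde{\mathcal S}\to\widetilde{\mathcal S}^1$ with $F_*\widetilde\Delta=\widetilde\Delta^1$, $F_*\mathcal C=\mathcal C^1$ and $F_*\mathcal V_i=\mathcal V_i^1$ for all $i$) if and only if the flag structures obtained from them by linearization are equivalent (there is a diffeomorphism $\psi\colon\mathcal S\to\mathcal S^1$ with $\psi_*\Delta=\Delta^1$ that maps $\mathcal Y^\gamma$ onto $(\mathcal Y^1)^{\psi(\gamma)}$ for all $\gamma\in\mathcal S$). 2. The same holds locally. For all $x\in\widetilde{\mathcal S}$ and $x_1\in\widetilde{\mathcal S}^1$, some diffeomorphism between neighborhoods of $x$ and of $x_1$ maps $x$ to $x_1$ and the first tuple to the second if and only if some diffeomorphism $\psi$ between open subsets of $\mathcal S$ and $\mathcal S^1$, whose domain contains $\Phi(x)$,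 maps $\Delta$ to $\Delta^1$, the flag $\mathcal Y^{\Phi(x)}(x)$ to the flag $(\mathcal Y^1)^{\Phi^1(x_1)}(x_1)$ (so $\psi(\Phi(x))=\Phi^1(x_1)$), and the part of $\bigcup_\gamma\mathcal Y^\gamma$ in some neighborhood (lying over the domain of $\psi$) of the first flag in the flag bundle onto the part of $\bigcup_\gamma(\mathcal Y^1)^\gamma$ in some neighborhood of the second flag. -/

import Mathlib

open scoped Manifold ContDiff Topology

noncomputable section

namespace FlagLin

/-! ### Distributions on manifolds -/

/-- A field of subspaces `D(x) ⊆ T_x M` on an `m`-dimensional manifold `M`. -/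
abbrev SubspaceField (m : ℕ) (M : Type*) [TopologicalSpace M]
    [ChartedSpace (EuclideanSpace ℝ (Fin m)) M] : Type _ :=
  ∀ x : M, Submodule ℝ (TangentSpace (𝓡 m) x)

variable {m : ℕ} {M : Type*} [TopologicalSpace M] [ChartedSpace (EuclideanSpace ℝ (Fin m)) M]
variable {m₁ : ℕ} {M₁ : Type*} [TopologicalSpace M₁] [ChartedSpace (EuclideanSpace ℝ (Fin m₁)) M₁]
variable {n : ℕ} {S : Type*} [TopologicalSpace S] [ChartedSpace (EuclideanSpace ℝ (Fin n)) S]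
variable {n₁ : ℕ} {S₁ : Type*} [TopologicalSpace S₁] [ChartedSpace (EuclideanSpace ℝ (Fin n₁)) S₁]

/-- The vector field `X` is smooth on the set `U`. -/
def SmoothFieldOn [IsManifold (𝓡 m) ∞ M] (X : ∀ x : M, TangentSpace (𝓡 m) x) (U : Set M) : Prop :=
  ContMDiffOn (𝓡 m) (𝓡 m).tangent ∞ (fun x ↦ (⟨x, X x⟩ : TangentBundle (𝓡 m) M)) U

/-- `D` is a (smooth) distribution, i.e. a smooth vector subbundle of the tangent bundle:
near every point it has a smooth frame. -/
def IsDistribution [IsManifold (𝓡 m) ∞ M] (D : SubspaceField m M) : Prop :=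
  ∀ x : M, ∃ (k : ℕ) (X : Fin k → ∀ y : M, TangentSpace (𝓡 m) y) (U : Set M),
    IsOpen U ∧ x ∈ U ∧ (∀ j, SmoothFieldOn (X j) U) ∧
      ∀ y ∈ U, LinearIndependent ℝ (fun j ↦ X j y) ∧
        D y = Submodule.span ℝ (Set.range fun j ↦ X j y)

/-- `[A, B] ⊆ D`: the Lie bracket of any two local sections of `A` and `B` takes values in `D`. -/
def BracketLE [IsManifold (𝓡 m) ∞ M] (A B D : SubspaceField m M) : Prop :=
  ∀ (U : Set M) (X Y : ∀ x : M, TangentSpace (𝓡 m) x), IsOpen U →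
    SmoothFieldOn X U → SmoothFieldOn Y U → (∀ x ∈ U, X x ∈ A x) → (∀ x ∈ U, Y x ∈ B x) →
      ∀ x ∈ U, VectorField.mlieBracket (𝓡 m) X Y x ∈ D x

/-! ### Tuples of distributions -/

/-- A tuple `(Δ̃, C, {V_i}_{i ∈ ℤ})` of fields of subspaces on `M`. -/
structure Tuple (m : ℕ) (M : Type*) [TopologicalSpace M]
    [ChartedSpace (EuclideanSpace ℝ (Fin m)) M] where
  /-- the ambient distribution -/
  Delta : SubspaceField m M
  /-- the distribution along whose leaves one linearizes -/
  C : SubspaceField m M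
  /-- the sequence of distributions to be linearized -/
  V : ℤ → SubspaceField m M

/-- All members of the tuple are distributions and (P1)-(P4) hold. -/
structure Tuple.IsAdmissible [IsManifold (𝓡 m) ∞ M] (T : Tuple m M) : Prop where
  isDistribution_Delta : IsDistribution T.Delta
  isDistribution_C : IsDistribution T.C
  isDistribution_V : ∀ i, IsDistribution (T.V i)
  -- (P1)
  C_le : ∀ x, T.C x ≤ T.Delta x
  V_le : ∀ i x, T.V i x ≤ T.Delta x
  -- (P2)
  integrable : BracketLE T.C T.C T.C
  symm : BracketLE T.C T.Delta T.Delta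
  -- (P3)
  antitone : ∀ i x, T.V i x ≤ T.V (i - 1) x
  stable_neg : ∃ (r : ℤ) (D : SubspaceField m M), ∀ i ≤ r, ∀ x, T.V i x ⊔ T.C x = D x
  stable_pos : ∃ s : ℤ, ∀ i, s ≤ i → T.V i = T.V s
  compat : ∀ i, BracketLE T.C (T.V i) (fun x ↦ T.V (i - 1) x ⊔ T.C x)
  -- (P4)
  finrank_inf : ∀ i, ∃ d : ℕ, ∀ x, Module.finrank ℝ ↥(T.V i x ⊓ T.C x) = d

/-- The linear map `A : T_x M → T_y M₁` carries the member of `T` at `x` onto those of `T₁` at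
`y`. -/
structure Tuple.MapsOnto (T : Tuple m M) (T₁ : Tuple m₁ M₁) (x : M) (y : M₁)
    (A : TangentSpace (𝓡 m) x →L[ℝ] TangentSpace (𝓡 m₁) y) : Prop where
  Delta : (T.Delta x).map A.toLinearMap = T₁.Delta y
  C : (T.C x).map A.toLinearMap = T₁.C y
  V : ∀ i, (T.V i x).map A.toLinearMap = T₁.V i y

/-- Equivalence of tuples: a diffeomorphism carries one onto the other. -/
def Tuple.Equivalent (T : Tuple m M) (T₁ : Tuple m₁ M₁) : Prop :=
  ∃ F : M ≃ₘ⟮𝓡 m, 𝓡 m₁⟯ M₁, ∀ x, T.MapsOnto T₁ x (F x) (mfderiv (𝓡 m) (𝓡 m₁) F x)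

/-- Local equivalence of the germ of `T` at `x` with the germ of `T₁` at `x₁`. -/
def Tuple.LocallyEquivalentAt (T : Tuple m M) (T₁ : Tuple m₁ M₁) (x : M) (x₁ : M₁) : Prop :=
  ∃ F : OpenPartialHomeomorph M M₁,
    ContMDiffOn (𝓡 m) (𝓡 m₁) ∞ F F.source ∧ ContMDiffOn (𝓡 m₁) (𝓡 m) ∞ F.symm F.target ∧
    x ∈ F.source ∧ F x = x₁ ∧
    ∀ y ∈ F.source, T.MapsOnto T₁ y (F y) (mfderiv (𝓡 m) (𝓡 m₁) F y)

/-! ### The manifold of leaves -/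

/-- `x` and `y` lie on the same leaf of the foliation by maximal integral submanifolds of `C`:
they are joined by finitely many smooth curves tangent to `C`. -/
def SameLeaf (C : SubspaceField m M) : M → M → Prop :=
  Relation.ReflTransGen fun x y ↦ ∃ c : ℝ → M, ContMDiff 𝓘(ℝ, ℝ) (𝓡 m) ∞ c ∧ c 0 = x ∧ c 1 = y ∧
    ∀ t, mfderiv 𝓘(ℝ, ℝ) (𝓡 m) c t (1 : ℝ) ∈ C (c t)

/-- `π : M → S` exhibits the manifold `S` as the quotient of `M` by the foliation by leaves of `C`:
it is a surjective smooth submersion whose fibers are the leaves. -/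
structure IsLeafSpace (C : SubspaceField m M) (π : M → S) : Prop where
  surjective : Function.Surjective π
  smooth : ContMDiff (𝓡 m) (𝓡 n) ∞ π
  submersion : ∀ x, Function.Surjective (mfderiv (𝓡 m) (𝓡 n) π x)
  ker_eq : ∀ x, (mfderiv (𝓡 m) (𝓡 n) π x).toLinearMap.ker = C x
  fiber_eq : ∀ x y, π x = π y ↔ SameLeaf C x y

/-! ### Flags in tangent spaces -/

/-- A point of the bundle of flags in the tangent spaces of `S`: a base point together with a
sequence of subspaces of the tangent space there. -/
structure FlagBundle (n : ℕ) (S : Type*) [TopologicalSpace S]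
    [ChartedSpace (EuclideanSpace ℝ (Fin n)) S] where
  /-- the base point -/
  base : S
  /-- the members of the flag -/
  flag : ℤ → Submodule ℝ (TangentSpace (𝓡 n) base)

/-- The differential at `γ` of the preferred chart at `γ₀`. -/
def chartDeriv (γ₀ γ : S) : TangentSpace (𝓡 n) γ →L[ℝ] EuclideanSpace ℝ (Fin n) :=
  mfderiv (𝓡 n) 𝓘(ℝ, EuclideanSpace ℝ (Fin n)) (extChartAt (𝓡 n) γ₀) γ

/-- The `i`-th member of the flag `Λ`, written in the preferred chart at `γ₀` and viewed as a point
of a Grassmannian of `ℝⁿ`; a point `W` of the Grassmannian is represented, as usual, by the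
orthogonal projection of `ℝⁿ` onto `W`. -/
def FlagBundle.proj (γ₀ : S) (Λ : FlagBundle n S) (i : ℤ) :
    EuclideanSpace ℝ (Fin n) →L[ℝ] EuclideanSpace ℝ (Fin n) :=
  ((Λ.flag i).map (chartDeriv γ₀ Λ.base).toLinearMap).starProjection

/-- The topology of the flag bundle: over the domain of the chart at `γ₀` it is the topology induced
by base point and projections. -/
instance : TopologicalSpace (FlagBundle n S) :=
  TopologicalSpace.generateFrom
    {A | ∃ (γ₀ : S) (O : Set (S × (ℤ → EuclideanSpace ℝ (Fin n) →L[ℝ] EuclideanSpace ℝ (Fin n)))),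
      IsOpen O ∧ A = {Λ | Λ.base ∈ (chartAt (EuclideanSpace ℝ (Fin n)) γ₀).source ∧
        (Λ.base, Λ.proj γ₀) ∈ O}}

/-- `f` is a smooth embedding of the manifold `M` into the flag bundle of `S`: it is smooth, its
differential is injective (both read off from base point and projections in the chart at the base
point), and it is a homeomorphism onto its image. -/
structure IsFlagEmbedding (f : M → FlagBundle n S) : Prop where
  smooth_base : ContMDiff (𝓡 m) (𝓡 n) ∞ fun y ↦ (f y).base
  smooth_proj : ∀ x i, ContMDiffAt (𝓡 m)
    𝓘(ℝ, EuclideanSpace ℝ (Fin n) →L[ℝ] EuclideanSpace ℝ (Fin n)) ∞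
    (fun y ↦ (f y).proj (f x).base i) x
  immersion : ∀ (x : M) (v : TangentSpace (𝓡 m) x),
    mfderiv (𝓡 m) (𝓡 n) (fun y ↦ (f y).base) x v = 0 →
    (∀ i, mfderiv (𝓡 m) 𝓘(ℝ, EuclideanSpace ℝ (Fin n) →L[ℝ] EuclideanSpace ℝ (Fin n))
      (fun y ↦ (f y).proj (f x).base i) x v = 0) → v = 0
  isEmbedding : Topology.IsEmbedding f

/-- The push-forward of flags by (the differential of) a map `ψ`. -/
def FlagBundle.push (ψ : S → S₁) (Λ : FlagBundle n S) : FlagBundle n₁ S₁ :=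
  ⟨ψ Λ.base, fun i ↦ (Λ.flag i).map (mfderiv (𝓡 n) (𝓡 n₁) ψ Λ.base).toLinearMap⟩

/-! ### Flag structures -/

/-- The data `(Δ, {Y^γ}_{γ ∈ S})` of a flag structure. The sets `Y^γ` are collected into one subset
`Y` of the flag bundle; `Y^γ` is the set of all flags in `Y` with base point `γ`. -/
structure FlagStructure (n : ℕ) (S : Type*) [TopologicalSpace S]
    [ChartedSpace (EuclideanSpace ℝ (Fin n)) S] where
  /-- the distribution on `S` -/
  Delta : SubspaceField n S
  /-- the union of the sets `Y^γ` -/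
  Y : Set (FlagBundle n S)

/-- Equivalence of flag structures: a diffeomorphism of the base manifolds carries `Δ` onto `Δ₁`
and each `Y^γ` onto `Y₁^{ψ γ}`. -/
def FlagStructure.Equivalent (Φ : FlagStructure n S) (Φ₁ : FlagStructure n₁ S₁) : Prop :=
  ∃ ψ : S ≃ₘ⟮𝓡 n, 𝓡 n₁⟯ S₁,
    (∀ γ, (Φ.Delta γ).map (mfderiv (𝓡 n) (𝓡 n₁) ψ γ).toLinearMap = Φ₁.Delta (ψ γ)) ∧
    FlagBundle.push ψ '' Φ.Y = Φ₁.Y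

/-- Local equivalence of flag structures at the flags `Λ` and `Λ₁`: a local diffeomorphism `ψ` of
the base manifolds carries `Λ` to `Λ₁`, `Δ` to `Δ₁`, and the part of `Y` in some neighbourhood `O`
of `Λ` onto the part of `Y₁` in some neighbourhood `O₁` of `Λ₁`. -/
def FlagStructure.LocallyEquivalentAt (Φ : FlagStructure n S) (Φ₁ : FlagStructure n₁ S₁)
    (Λ : FlagBundle n S) (Λ₁ : FlagBundle n₁ S₁) : Prop :=
  ∃ ψ : OpenPartialHomeomorph S S₁,
    ContMDiffOn (𝓡 n) (𝓡 n₁) ∞ ψ ψ.source ∧ ContMDiffOn (𝓡 n₁) (𝓡 n) ∞ ψ.symm ψ.target ∧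
    Λ.base ∈ ψ.source ∧ Λ.push ψ = Λ₁ ∧
    (∀ γ ∈ ψ.source,
      (Φ.Delta γ).map (mfderiv (𝓡 n) (𝓡 n₁) ψ γ).toLinearMap = Φ₁.Delta (ψ γ)) ∧
    ∃ (O : Set (FlagBundle n S)) (O₁ : Set (FlagBundle n₁ S₁)), IsOpen O ∧ IsOpen O₁ ∧
      Λ ∈ O ∧ Λ₁ ∈ O₁ ∧ (∀ Θ ∈ O, Θ.base ∈ ψ.source) ∧
      FlagBundle.push ψ '' (Φ.Y ∩ O) = Φ₁.Y ∩ O₁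

/-! ### Linearization -/

/-- The flag `Y^γ(x) = {π_* V_i(x)}_{i ∈ ℤ}` in the tangent space at `γ = π x`. -/
def Tuple.linearization (T : Tuple m M) (π : M → S) (x : M) : FlagBundle n S :=
  ⟨π x, fun i ↦ (T.V i x).map (mfderiv (𝓡 m) (𝓡 n) π x).toLinearMap⟩

/-- The push-forward of a field of subspaces: its value at `γ` is spanned by the images
`π_* D(x)`, `x ∈ π⁻¹(γ)` (they all coincide when the sections of `ker π_*` are infinitesimal
symmetries of `D` and the fibers are connected). -/
def pushforward (D : SubspaceField m M) (π : M → S) : SubspaceField n S := fun γ ↦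
  ⨆ (x : M) (h : π x = γ), h ▸ (D x).map (mfderiv (𝓡 m) (𝓡 n) π x).toLinearMap

/-- The flag structure `(π_* Δ̃, {Y^γ})` obtained by linearization along the fibers of `π`;
`Y^γ` is the image of `π⁻¹(γ)`. -/
def Tuple.flagStructure (T : Tuple m M) (π : M → S) : FlagStructure n S :=
  ⟨pushforward T.Delta π, Set.range (T.linearization (n := n) π)⟩

end FlagLin

end

/-!
Since `C` is contained in `Δ̃` and in all `V i`, and `C` is the kernel of the differential of the
projection `π` to the leaf space, every member of the tuple at a point `x` is the preimage under
`dπ` of its image. So the tuple can be recovered from `π`, from the flag of `x` and from `π_* Δ̃`.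

For this `π_* Δ̃` has to be computed at `x` alone, that is, `dπ(Δ̃(x))` has to be the same for all `x`
in a leaf (`pushforward_apply`). Along a curve tangent to `C`, the vectors `dπ(X_j)`, for a frame
`X_j` of `Δ̃`, satisfy a linear system of differential equations because `[C, Δ̃] ⊆ Δ̃`, hence their
span is constant (`eventually_span_fderiv_eq`).

*From tuples to flag structures.* A diffeomorphism `F` carrying `C` onto `C₁` maps leaves to leaves
and so descends to a map `ψ` of the leaf spaces. It is smooth, also locally, since a map whose
differential kills the kernel of that of a submersion factors locally through the submersion
(`exists_factor_of_ker_mfderiv_le`). From `ψ ∘ π = π₁ ∘ F` it follows that `ψ` carries flags to flags.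

*From flag structures to tuples.* Let `Y`, `Y₁` be the embeddings into the flag bundles and let `ψ`
be an equivalence. Then `F = Y₁⁻¹ ∘ ψ_* ∘ Y` is a bijection between the relevant open sets. The map
`ψ_* ∘ Y` is smooth, since the orthogonal projection onto the range of an idempotent `Q` is the smooth
function `Q (Q + Q* - 1)⁻¹` of `Q` (`IsPartialDiffeo.contMDiffAt_proj_push`). As `Y₁` is a homeomorphism
onto its image, `F` is continuous; as `Y₁` is an immersion, it has locally a left inverse that is a
smooth function of finitely many coordinates, so `F` is smooth (`IsFlagEmbedding.contMDiffAt_of_comp`).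
By the first remark `F` carries one tuple onto the other (`mapsOnto_of_push_eq`).
-/

namespace FlagLin

/-! ### Smooth dependence of orthogonal projections -/

section Projections

variable {E E₁ : Type*} [NormedAddCommGroup E] [InnerProductSpace ℝ E] [FiniteDimensional ℝ E]
  [NormedAddCommGroup E₁] [InnerProductSpace ℝ E₁] [FiniteDimensional ℝ E₁]

/-- The orthogonal projection `P` onto the range of an idempotent `Q` satisfies `P * Q = Q` and
`P * Q* = P`. -/
theorem starProjection_mul_of_range_eq (Q : E →L[ℝ] E) (hQ : Q * Q = Q) (W : Submodule ℝ E)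
    (hW : Q.toLinearMap.range = W) : W.starProjection * (Q + star Q - 1) = Q := by
  have h1 : W.starProjection * Q = Q := by
    ext v
    exact Submodule.starProjection_eq_self_iff.2 (hW ▸ LinearMap.mem_range_self Q.toLinearMap v)
  have h2 : Q * W.starProjection = W.starProjection := by
    ext v
    obtain ⟨w, hw⟩ : W.starProjection v ∈ Q.toLinearMap.range :=
      hW ▸ Submodule.starProjection_apply_mem W v
    have hw' : Q w = W.starProjection v := hw
    simp only [mul_apply_eq_comp, ← hw']
    rw [← mul_apply_eq_comp, hQ]
  have h3 : star (W.starProjection) = W.starProjection := isSelfAdjoint_starProjection W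
  have h4 : W.starProjection * star Q = W.starProjection := by
    rw [← h3, ← star_mul, h2]
  rw [mul_sub, mul_add, h1, h4]
  simp

/-- If `(Q + Q* - 1) v = 0`, then `Q v = 0` because `Q = P * (Q + Q* - 1)`, hence `Q* v = v` and
`⟪v, v⟫ = ⟪Q v, v⟫ = 0`. -/
theorem isUnit_add_star_sub_one (Q : E →L[ℝ] E) (hQ : Q * Q = Q) : IsUnit (Q + star Q - 1) := by
  have key := starProjection_mul_of_range_eq Q hQ _ rfl
  have hinj : Function.Injective (Q + star Q - 1 : E →L[ℝ] E) := by
    refine (injective_iff_map_eq_zero _).2 fun v hv ↦ ?_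
    have h1 : Q v = 0 := by
      rw [← key, mul_apply_eq_comp, hv, map_zero]
    have h2 : star Q v = v := by
      have : Q v + star Q v - v = 0 := by simpa using hv
      rw [h1, zero_add, sub_eq_zero] at this
      exact this
    have h3 : inner ℝ v v = 0 := by
      nth_rw 1 [← h2]
      rw [ContinuousLinearMap.star_eq_adjoint, ContinuousLinearMap.adjoint_inner_left, h1,
        inner_zero_right]
    exact inner_self_eq_zero.1 h3
  rw [ContinuousLinearMap.isUnit_iff_bijective]
  exact ⟨hinj, (LinearMap.injective_iff_surjective (f := (Q + star Q - 1).toLinearMap)).1 hinj⟩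

/-- A smooth formula for the orthogonal projection onto the range of an idempotent. -/
theorem starProjection_eq_of_range_eq (Q : E →L[ℝ] E) (hQ : Q * Q = Q) (W : Submodule ℝ E)
    (hW : Q.toLinearMap.range = W) :
    W.starProjection = Q * Ring.inverse (Q + star Q - 1) := by
  have h := starProjection_mul_of_range_eq Q hQ W hW
  have hu := isUnit_add_star_sub_one Q hQ
  calc W.starProjection
      = W.starProjection * ((Q + star Q - 1) * Ring.inverse (Q + star Q - 1)) := by
        rw [Ring.mul_inverse_cancel _ hu, mul_one]
    _ = Q * Ring.inverse (Q + star Q - 1) := by rw [← mul_assoc, h]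

theorem contDiffAt_mul_inverse_add_star (Q : E →L[ℝ] E) (hQ : Q * Q = Q) :
    ContDiffAt ℝ ∞ (fun Q : E →L[ℝ] E ↦ Q * Ring.inverse (Q + star Q - 1)) Q := by
  refine contDiffAt_id.mul ?_
  obtain ⟨u, hu⟩ := isUnit_add_star_sub_one Q hQ
  have h1 := contDiffAt_ringInverse (n := ∞) ℝ u
  rw [hu] at h1
  refine ContDiffAt.comp (f := fun Q : E →L[ℝ] E ↦ Q + star Q - 1) Q h1 ?_
  have h2 : ContDiff ℝ ∞ (fun Q : E →L[ℝ] E ↦ star Q) :=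
    (starL' ℝ : (E →L[ℝ] E) ≃L[ℝ] (E →L[ℝ] E)).contDiff
  exact ((contDiff_id.add h2).sub contDiff_const).contDiffAt

/-- The point `A(y) W(y)` of the Grassmannian depends smoothly on `y` if `W(y)` and the
isomorphism `A(y)` do: `A P_W A⁻¹` is an idempotent with range `A W`. -/
theorem contMDiffAt_starProjection_map {m : ℕ} {M : Type*} [TopologicalSpace M]
    [ChartedSpace (EuclideanSpace ℝ (Fin m)) M] {x : M} {A : M → E →L[ℝ] E₁} {B : M → E₁ →L[ℝ] E}
    {W : M → Submodule ℝ E}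
    (hA : ContMDiffAt (𝓡 m) 𝓘(ℝ, E →L[ℝ] E₁) ∞ A x)
    (hB : ContMDiffAt (𝓡 m) 𝓘(ℝ, E₁ →L[ℝ] E) ∞ B x)
    (hW : ContMDiffAt (𝓡 m) 𝓘(ℝ, E →L[ℝ] E) ∞ (fun y ↦ (W y).starProjection) x)
    (hBA : ∀ᶠ y in 𝓝 x, B y ∘L A y = ContinuousLinearMap.id ℝ E)
    (hAB : ∀ᶠ y in 𝓝 x, A y ∘L B y = ContinuousLinearMap.id ℝ E₁) :
    ContMDiffAt (𝓡 m) 𝓘(ℝ, E₁ →L[ℝ] E₁) ∞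
      (fun y ↦ ((W y).map (A y).toLinearMap).starProjection) x := by
  have hQs : ContMDiffAt (𝓡 m) 𝓘(ℝ, E₁ →L[ℝ] E₁) ∞
      (fun y ↦ A y ∘L ((W y).starProjection ∘L B y)) x := hA.clm_comp (hW.clm_comp hB)
  have hid : ∀ᶠ y in 𝓝 x, (A y ∘L ((W y).starProjection ∘L B y)) *
      (A y ∘L ((W y).starProjection ∘L B y)) = A y ∘L ((W y).starProjection ∘L B y) ∧
      (A y ∘L ((W y).starProjection ∘L B y)).toLinearMap.range = (W y).map (A y).toLinearMap := by
    filter_upwards [hBA, hAB] with y h1 h2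
    have h1' : ∀ v, B y (A y v) = v := fun v ↦ DFunLike.congr_fun h1 v
    have h2' : ∀ v, A y (B y v) = v := fun v ↦ DFunLike.congr_fun h2 v
    constructor
    · ext v
      have h3 : ∀ w, (W y).starProjection ((W y).starProjection w) = (W y).starProjection w :=
        fun w ↦ Submodule.starProjection_eq_self_iff.2 (Submodule.starProjection_apply_mem _ _)
      simp [h1', h3]
    · ext v
      simp only [LinearMap.mem_range, Submodule.mem_map, ContinuousLinearMap.coe_coe,
        ContinuousLinearMap.comp_apply]
      constructor
      · rintro ⟨w, rfl⟩
        exact ⟨_, Submodule.starProjection_apply_mem _ _, rfl⟩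
      · rintro ⟨w, hw, rfl⟩
        exact ⟨A y w, by rw [h1', Submodule.starProjection_eq_self_iff.2 hw]⟩
  have hx := hid.self_of_nhds
  refine (ContMDiffAt.comp x (contDiffAt_mul_inverse_add_star _ hx.1).contMDiffAt
    hQs).congr_of_eventuallyEq ?_
  filter_upwards [hid] with y hy
  exact starProjection_eq_of_range_eq _ hy.1 _ hy.2

end Projections

/-! ### Consequences of the inverse function theorem -/

section InverseFunction

variable {E F G : Type*} [NormedAddCommGroup E] [NormedSpace ℝ E] [FiniteDimensional ℝ E]
  [NormedAddCommGroup F] [NormedSpace ℝ F] [FiniteDimensional ℝ F]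
  [NormedAddCommGroup G] [NormedSpace ℝ G]

/-- Inverse function theorem, with the inverse smooth on all of its domain. -/
theorem exists_openPartialHomeomorph_of_hasFDerivAt_id {f : E → E} {Ω : Set E} {u₀ : E}
    (hΩ : IsOpen Ω) (hu₀ : u₀ ∈ Ω) (hf : ContDiffOn ℝ ∞ f Ω)
    (hd : HasFDerivAt f (ContinuousLinearMap.id ℝ E) u₀) :
    ∃ e : OpenPartialHomeomorph E E, u₀ ∈ e.source ∧ e.source ⊆ Ω ∧ (∀ u, e u = f u) ∧
      ContDiffOn ℝ ∞ e.symm e.target := by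
  have hfa : ContDiffAt ℝ ∞ f u₀ := hf.contDiffAt (hΩ.mem_nhds hu₀)
  have hd' : HasFDerivAt f ((ContinuousLinearEquiv.refl ℝ E : E ≃L[ℝ] E) : E →L[ℝ] E) u₀ := hd
  let e₀ := hfa.toOpenPartialHomeomorph f hd' (by simp)
  have he₀ : ∀ u, e₀ u = f u := fun u ↦ rfl
  have hcont : ContinuousOn (fderiv ℝ f) Ω :=
    hf.continuousOn_fderiv_of_isOpen hΩ (by simp)
  let I : Set (E →L[ℝ] E) := {A | IsUnit A}
  have hI : IsOpen I := Units.isOpen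
  -- smoothness of the inverse at a point needs the derivative to be invertible there
  let Ω' := Ω ∩ fderiv ℝ f ⁻¹' I
  have hΩ' : IsOpen Ω' := hcont.isOpen_inter_preimage hΩ hI
  refine ⟨e₀.restrOpen Ω' hΩ', ?_, ?_, he₀, ?_⟩
  · refine ⟨hfa.mem_toOpenPartialHomeomorph_source hd' (by simp), hu₀, ?_⟩
    change IsUnit (fderiv ℝ f u₀)
    rw [hd.fderiv]
    exact isUnit_one
  · rintro u ⟨-, hu, -⟩
    exact hu
  · intro w hw
    set e := e₀.restrOpen Ω' hΩ'
    have hs := e.map_target hw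
    obtain ⟨-, h1, h2⟩ := hs
    have h2' : IsUnit (fderiv ℝ f (e.symm w)) := h2
    obtain ⟨A, hA⟩ := h2'
    have h3 : ContDiffAt ℝ ∞ f (e.symm w) := hf.contDiffAt (hΩ.mem_nhds h1)
    have h4 : HasFDerivAt e (ContinuousLinearEquiv.unitsEquiv ℝ E A : E →L[ℝ] E) (e.symm w) := by
      have := (h3.differentiableAt (by simp)).hasFDerivAt
      rw [← hA] at this
      exact this
    exact (e.contDiffAt_symm hw h4 h3).contDiffWithinAt

/-- A map with injective differential has a smooth local left inverse: if `L` is a linear left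
inverse of the differential, then `L ∘ f` is a local diffeomorphism. -/
theorem exists_leftInverse_of_injective_fderiv {f : E → F} {u₀ : E}
    {Ω : Set E} (hΩ : IsOpen Ω) (hu₀ : u₀ ∈ Ω) (hf : ContDiffOn ℝ ∞ f Ω)
    (hinj : Function.Injective (fderiv ℝ f u₀)) :
    ∃ ρ : F → E, ContDiffAt ℝ ∞ ρ (f u₀) ∧ ∀ᶠ u in 𝓝 u₀, ρ (f u) = u := by
  obtain ⟨L₀, hL₀⟩ := (fderiv ℝ f u₀).toLinearMap.exists_leftInverse_of_injective
    (LinearMap.ker_eq_bot.2 hinj)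
  let L : F →L[ℝ] E := LinearMap.toContinuousLinearMap L₀
  have hfd : HasFDerivAt f (fderiv ℝ f u₀) u₀ :=
    ((hf.contDiffAt (hΩ.mem_nhds hu₀)).differentiableAt (by simp)).hasFDerivAt
  have hd : HasFDerivAt (fun u ↦ L (f u)) (ContinuousLinearMap.id ℝ E) u₀ := by
    have : L ∘L fderiv ℝ f u₀ = ContinuousLinearMap.id ℝ E := by
      ext v
      exact LinearMap.congr_fun hL₀ v
    rw [← this]
    exact L.hasFDerivAt.comp u₀ hfd
  obtain ⟨e, h1, -, h3, h4⟩ := exists_openPartialHomeomorph_of_hasFDerivAt_id hΩ hu₀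
    (L.contDiff.comp_contDiffOn hf) hd
  refine ⟨fun w ↦ e.symm (L w), ?_, ?_⟩
  · have h5 : L (f u₀) ∈ e.target := by
      have := e.map_source h1
      rwa [h3 u₀] at this
    exact ContDiffAt.comp (f u₀) (h4.contDiffAt (e.open_target.mem_nhds h5)) L.contDiff.contDiffAt
  · filter_upwards [e.open_source.mem_nhds h1] with u hu
    have := e.left_inv hu
    rwa [h3 u] at this

/-- A map whose differential vanishes on the kernel of the differential of a submersion factors
locally through the submersion. If `R` is a right inverse of `A = dh(u₀)`, then
`Ψ u = R (h u) + (1 - R A) u` is a local diffeomorphism with `h = A ∘ Ψ`, so that `h` becomes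
linear in the coordinates `Ψ`. -/
theorem exists_factor_of_ker_le {h : E → F} {f : E → G} {u₀ : E}
    {Ω : Set E} (hΩ : IsOpen Ω) (hu₀ : u₀ ∈ Ω) (hh : ContDiffOn ℝ ∞ h Ω)
    (hf : ContDiffOn ℝ ∞ f Ω) (hsurj : Function.Surjective (fderiv ℝ h u₀))
    (hker : ∀ u ∈ Ω, ∀ v, fderiv ℝ h u v = 0 → fderiv ℝ f u v = 0) :
    ∃ (V : Set E) (g : F → G), IsOpen V ∧ u₀ ∈ V ∧ V ⊆ Ω ∧ IsOpen (h '' V) ∧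
      ContDiffOn ℝ ∞ g (h '' V) ∧ ∀ u ∈ V, f u = g (h u) := by
  set A := fderiv ℝ h u₀ with hA
  obtain ⟨R₀, hR₀⟩ := A.toLinearMap.exists_rightInverse_of_surjective
    (LinearMap.range_eq_top.2 hsurj)
  let R : F →L[ℝ] E := LinearMap.toContinuousLinearMap R₀
  have hAR : ∀ b, A (R b) = b := fun b ↦ LinearMap.congr_fun hR₀ b
  have hhd : HasFDerivAt h A u₀ :=
    ((hh.contDiffAt (hΩ.mem_nhds hu₀)).differentiableAt (by simp)).hasFDerivAt
  let Ψ : E → E := fun u ↦ R (h u) + (ContinuousLinearMap.id ℝ E - R ∘L A) u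
  have hΨd : HasFDerivAt Ψ (ContinuousLinearMap.id ℝ E) u₀ := by
    have h1 := (R.hasFDerivAt.comp u₀ hhd).add
      (ContinuousLinearMap.id ℝ E - R ∘L A).hasFDerivAt
    have h2 : R ∘L A + (ContinuousLinearMap.id ℝ E - R ∘L A) = ContinuousLinearMap.id ℝ E := by
      abel
    rw [h2] at h1
    exact h1
  have hΨs : ContDiffOn ℝ ∞ Ψ Ω := (R.contDiff.comp_contDiffOn hh).add
    (ContinuousLinearMap.contDiff _).contDiffOn
  obtain ⟨e, h1, h2, h3, h4⟩ := exists_openPartialHomeomorph_of_hasFDerivAt_id hΩ hu₀ hΨs hΨd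
  have hhe : ∀ u, h u = A (e u) := by
    intro u
    rw [h3 u]
    simp [Ψ, hAR]
  have hhes : ∀ w ∈ e.target, h (e.symm w) = A w := fun w hw ↦ by rw [hhe, e.right_inv hw]
  set w₀ := e u₀ with hw₀
  have hw₀t : w₀ ∈ e.target := e.map_source h1
  obtain ⟨ε, hε, hB⟩ := Metric.isOpen_iff.1 e.open_target w₀ hw₀t
  let s : F → E := fun b ↦ w₀ + R (b - A w₀)
  have hs : ContDiff ℝ ∞ s := contDiff_const.add (R.contDiff.comp (contDiff_id.sub contDiff_const))
  have hAs : ∀ b, A (s b) = b := fun b ↦ by simp [s, hAR]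
  have hs₀ : s (A w₀) = w₀ := by simp [s]
  -- `s (A w)` lies in the plane through `w₀` transversal to `ker A`; `B'` keeps it in the ball
  let B' : Set E := Metric.ball w₀ ε ∩ (fun w ↦ s (A w)) ⁻¹' Metric.ball w₀ ε
  have hB'o : IsOpen B' := Metric.isOpen_ball.inter
    (Metric.isOpen_ball.preimage (hs.continuous.comp A.continuous))
  have hB't : B' ⊆ e.target := fun w hw ↦ hB hw.1
  have himage : h '' (e.symm '' B') = A '' B' := by
    rw [Set.image_image]
    exact Set.image_congr fun w hw ↦ hhes w (hB't hw)
  have hAopen : IsOpenMap A := A.isOpenMap hsurj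
  refine ⟨e.symm '' B', fun b ↦ f (e.symm (s b)), ?_, ?_, ?_, ?_, ?_, ?_⟩
  · exact e.isOpen_image_symm_of_subset_target hB'o hB't
  · refine ⟨w₀, ⟨Metric.mem_ball_self hε, ?_⟩, e.left_inv h1⟩
    change s (A w₀) ∈ Metric.ball w₀ ε
    rw [hs₀]
    exact Metric.mem_ball_self hε
  · rintro _ ⟨w, hw, rfl⟩
    exact h2 (e.map_target (hB't hw))
  · rw [himage]
    exact hAopen _ hB'o
  · rw [himage]
    refine (hf.comp h4 fun w hw ↦ h2 (e.map_target hw)).comp hs.contDiffOn ?_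
    rintro _ ⟨w, hw, rfl⟩
    exact hB hw.2
  · rintro _ ⟨w, hw, rfl⟩
    rw [hhes w (hB't hw)]
    -- join `w` to `s (A w)` inside the ball, along a segment in the direction of `ker A`
    have hfe : ContDiffOn ℝ ∞ (fun w ↦ f (e.symm w)) (Metric.ball w₀ ε) :=
      hf.comp (h4.mono hB) fun w hw ↦ h2 (e.map_target (hB hw))
    have hderiv : ∀ w ∈ Metric.ball w₀ ε, ∀ v, A v = 0 → fderiv ℝ (fun w ↦ f (e.symm w)) w v = 0 := by
      intro w hw v hv
      have hwt := hB hw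
      have he : HasFDerivAt e.symm (fderiv ℝ e.symm w) w :=
        ((h4.contDiffAt (e.open_target.mem_nhds hwt)).differentiableAt (by simp)).hasFDerivAt
      have hes : e.symm w ∈ Ω := h2 (e.map_target hwt)
      have hf' := ((hf.contDiffAt (hΩ.mem_nhds hes)).differentiableAt (by simp)).hasFDerivAt
      have hh' := ((hh.contDiffAt (hΩ.mem_nhds hes)).differentiableAt (by simp)).hasFDerivAt
      have hAw : HasFDerivAt (fun w ↦ h (e.symm w)) A w := by
        refine A.hasFDerivAt.congr_of_eventuallyEq ?_
        filter_upwards [e.open_target.mem_nhds hwt] with w' hw'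
        exact hhes w' hw'
      have hu := hAw.unique (hh'.comp w he)
      have h0 : fderiv ℝ h (e.symm w) (fderiv ℝ e.symm w v) = 0 := by
        rw [← hv, hu]; rfl
      have hfe' : HasFDerivAt (fun w ↦ f (e.symm w)) _ w := hf'.comp w he
      rw [hfe'.fderiv]
      exact hker _ hes _ h0
    have hseg : ∀ t ∈ Set.Icc (0 : ℝ) 1, w + t • (s (A w) - w) ∈ Metric.ball w₀ ε := by
      intro t ht
      have := (convex_ball w₀ ε).add_smul_sub_mem hw.1 hw.2 ht
      exact this
    have hconst := constant_of_has_deriv_right_zero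
      (f := fun t : ℝ ↦ f (e.symm (w + t • (s (A w) - w)))) (a := 0) (b := 1) ?_ ?_ 1 (by simp)
    · simpa using hconst.symm
    · intro t ht
      have := (hfe.contDiffAt (Metric.isOpen_ball.mem_nhds (hseg t ht))).continuousAt
      refine ContinuousAt.continuousWithinAt ?_
      exact ContinuousAt.comp (f := fun t : ℝ ↦ w + t • (s (A w) - w)) this (by fun_prop)
    · intro t ht
      have ht' := hseg t ⟨ht.1, ht.2.le⟩
      have h5 := ((hfe.contDiffAt (Metric.isOpen_ball.mem_nhds ht')).differentiableAt
        (by simp)).hasFDerivAt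
      have h6 : HasDerivAt (fun t : ℝ ↦ w + t • (s (A w) - w)) (s (A w) - w) t := by
        simpa using ((hasDerivAt_id t).smul_const (s (A w) - w)).const_add w
      have h7 := h5.comp_hasDerivAt t h6
      rw [hderiv _ ht' _ (by rw [map_sub, hAs, sub_self])] at h7
      exact h7.hasDerivWithinAt

end InverseFunction

/-! ### Transport along the leaves, in coordinates -/

section Transport

variable {E F : Type*} [NormedAddCommGroup E] [NormedSpace ℝ E]
  [NormedAddCommGroup F] [InnerProductSpace ℝ F]

/-- If `h` is constant along `Z`, then the derivative of `dh(X)` along `Z` is `dh([Z, X])`. -/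
theorem fderiv_fderiv_apply_eq_lieBracket {h : E → F} {X Z : E → E} {Ω : Set E} (hΩ : IsOpen Ω)
    (hh : ContDiffOn ℝ ∞ h Ω) (hX : ContDiffOn ℝ ∞ X Ω) (hZ : ContDiffOn ℝ ∞ Z Ω)
    (hhZ : ∀ u ∈ Ω, fderiv ℝ h u (Z u) = 0) {u : E} (hu : u ∈ Ω) :
    fderiv ℝ (fun u ↦ fderiv ℝ h u (X u)) u (Z u) =
      fderiv ℝ h u (VectorField.lieBracket ℝ Z X u) := by
  have hΩu := hΩ.mem_nhds hu
  have hha := hh.contDiffAt hΩu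
  have h1 : HasFDerivAt (fderiv ℝ h) (fderiv ℝ (fderiv ℝ h) u) u :=
    ((hha.fderiv_right (m := ∞) (by simp)).differentiableAt (by simp)).hasFDerivAt
  have h2 := ((hX.contDiffAt hΩu).differentiableAt (by simp)).hasFDerivAt
  have h3 := ((hZ.contDiffAt hΩu).differentiableAt (by simp)).hasFDerivAt
  have h4 := h1.clm_apply h2
  have h5 := h1.clm_apply h3
  have h6 : HasFDerivAt (fun u ↦ fderiv ℝ h u (Z u)) (0 : E →L[ℝ] F) u := by
    refine (hasFDerivAt_const (0 : F) u).congr_of_eventuallyEq ?_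
    filter_upwards [hΩu] with w hw
    exact hhZ w hw
  have h7 := DFunLike.congr_fun (h5.unique h6) (X u)
  have hsymm : fderiv ℝ (fderiv ℝ h) u (Z u) (X u) = fderiv ℝ (fderiv ℝ h) u (X u) (Z u) :=
    (hha.isSymmSndFDerivAt (by simpa using ENat.LEInfty.out)).eq _ _
  rw [h4.fderiv, VectorField.lieBracket_eq, map_sub]
  simp only [add_apply, ContinuousLinearMap.comp_apply,
    ContinuousLinearMap.flip_apply, zero_apply] at h7 ⊢
  rw [hsymm, eq_neg_of_add_eq_zero_right h7]
  abel

variable [FiniteDimensional ℝ E] [FiniteDimensional ℝ F]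

/-- Near a point where a frame is linearly independent, coefficients with respect to the frame are
bounded by the vector they represent. -/
theorem exists_norm_le_of_linearIndependent {k : ℕ} {X : Fin k → E → E} {u₀ : E}
    (hX : ∀ i, ContinuousAt (X i) u₀) (hli : LinearIndependent ℝ fun i ↦ X i u₀) :
    ∃ c : ℝ, 0 ≤ c ∧ ∀ᶠ u in 𝓝 u₀, ∀ b : Fin k → ℝ, ‖b‖ ≤ c * ‖∑ i, b i • X i u‖ := by
  obtain ⟨L₀, hL₀⟩ := (Fintype.linearCombination ℝ fun i ↦ X i u₀).exists_leftInverse_of_injective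
    (LinearMap.ker_eq_bot.2 (LinearIndependent.fintypeLinearCombination_injective hli))
  let L : E →L[ℝ] (Fin k → ℝ) := LinearMap.toContinuousLinearMap L₀
  have hL : ∀ b : Fin k → ℝ, L (∑ i, b i • X i u₀) = b := fun b ↦ by
    have := LinearMap.congr_fun hL₀ b
    rwa [LinearMap.comp_apply, Fintype.linearCombination_apply] at this
  refine ⟨2 * ‖L‖, by positivity, ?_⟩
  have hsmall : ∀ᶠ u in 𝓝 u₀, ‖L‖ * ∑ i, ‖X i u - X i u₀‖ < 1 / 2 := by
    have : ContinuousAt (fun u ↦ ‖L‖ * ∑ i, ‖X i u - X i u₀‖) u₀ := by fun_prop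
    refine this.eventually_lt continuousAt_const ?_
    simp
  filter_upwards [hsmall] with u hu b
  have h1 : b = L (∑ i, b i • X i u) - L (∑ i, b i • (X i u - X i u₀)) := by
    rw [← map_sub, ← Finset.sum_sub_distrib]
    simp_rw [smul_sub, sub_sub_cancel]
    exact (hL b).symm
  have h2 : ‖∑ i, b i • (X i u - X i u₀)‖ ≤ ‖b‖ * ∑ i, ‖X i u - X i u₀‖ := by
    rw [Finset.mul_sum]
    refine (norm_sum_le _ _).trans (Finset.sum_le_sum fun i _ ↦ ?_)
    rw [norm_smul]
    exact mul_le_mul_of_nonneg_right (norm_le_pi_norm b i) (norm_nonneg _)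
  have h3 : ‖b‖ ≤ ‖L‖ * ‖∑ i, b i • X i u‖ + ‖L‖ * (‖b‖ * ∑ i, ‖X i u - X i u₀‖) := by
    conv_lhs => rw [h1]
    refine (norm_sub_le _ _).trans (add_le_add (L.le_opNorm _) ((L.le_opNorm _).trans ?_))
    exact mul_le_mul_of_nonneg_left h2 (norm_nonneg _)
  nlinarith [norm_nonneg b, mul_le_mul_of_nonneg_left hu.le (norm_nonneg b)]

/-- Curves solving a linear system of differential equations with bounded coefficients span a
constant subspace: modulo the span at time `t₁`, the curves solve the same system with initial value
`0` at `t₁`, hence vanish. -/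
theorem eventually_span_eq_of_hasDerivAt {k : ℕ} {g : Fin k → ℝ → F} {t₀ K : ℝ}
    (hg : ∀ᶠ t in 𝓝 t₀, ∀ j, ∃ b : Fin k → ℝ, ‖b‖ ≤ K ∧ HasDerivAt (g j) (∑ i, b i • g i t) t) :
    ∀ᶠ t in 𝓝 t₀, Submodule.span ℝ (Set.range fun j ↦ g j t) =
      Submodule.span ℝ (Set.range fun j ↦ g j t₀) := by
  obtain ⟨ε, hε, hball⟩ := Metric.eventually_nhds_iff_ball.1 hg
  rw [Real.ball_eq_Ioo] at hball
  have hK : 0 ≤ K ∨ k = 0 := by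
    rcases k with _ | k
    · exact Or.inr rfl
    · obtain ⟨b, hb, -⟩ := hball t₀ (by constructor <;> linarith) 0
      exact Or.inl ((norm_nonneg b).trans hb)
  choose! b hb hgd using hball
  have key : ∀ t₁ ∈ Set.Ioo (t₀ - ε) (t₀ + ε), ∀ t ∈ Set.Ioo (t₀ - ε) (t₀ + ε),
      Submodule.span ℝ (Set.range fun j ↦ g j t) ≤ Submodule.span ℝ (Set.range fun j ↦ g j t₁) := by
    intro t₁ ht₁ t ht
    rcases hK with hK | rfl
    swap
    · simp
    set W := Submodule.span ℝ (Set.range fun j ↦ g j t₁) with hW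
    let q := Wᗮ.starProjection
    let v : ℝ → (Fin k → F) → (Fin k → F) := fun t x j ↦ ∑ i, b t j i • x i
    have hv : ∀ t ∈ Set.Ioo (t₀ - ε) (t₀ + ε),
        LipschitzOnWith (Real.toNNReal (k * K)) (v t) Set.univ := by
      intro t ht
      refine LipschitzOnWith.of_dist_le_mul fun x _ y _ ↦ ?_
      rw [Real.coe_toNNReal _ (by positivity)]
      refine (dist_pi_le_iff (by positivity)).2 fun j ↦ ?_
      rw [dist_eq_norm, ← Finset.sum_sub_distrib]
      refine (norm_sum_le _ _).trans ?_
      have : ∀ i ∈ (Finset.univ : Finset (Fin k)), ‖b t j i • x i - b t j i • y i‖ ≤ K * dist x y := by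
        intro i _
        rw [← smul_sub, norm_smul, ← dist_eq_norm]
        exact mul_le_mul ((norm_le_pi_norm _ i).trans (hb t ht j)) (dist_le_pi_dist x y i)
          dist_nonneg hK
      refine (Finset.sum_le_card_nsmul _ _ _ this).trans ?_
      simp [mul_assoc]
    have heq := ODE_solution_unique_of_mem_Ioo (v := v) (f := fun t j ↦ q (g j t)) (g := fun _ ↦ 0)
      hv ht₁ ?_ ?_ ?_ ht
    · rw [Submodule.span_le]
      rintro _ ⟨j, rfl⟩
      have : q (g j t) = 0 := congrFun heq j
      have h2 := (Submodule.starProjection_apply_eq_zero_iff Wᗮ).1 this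
      rwa [Submodule.orthogonal_orthogonal] at h2
    · intro t ht
      refine ⟨hasDerivAt_pi.2 fun j ↦ ?_, trivial⟩
      have h1 := q.hasFDerivAt.comp_hasDerivAt t (hgd t ht j)
      rw [map_sum] at h1
      simp_rw [map_smul] at h1
      exact h1
    · intro t ht
      refine ⟨?_, trivial⟩
      have : v t 0 = 0 := by ext j; simp [v]
      change HasDerivAt (fun _ ↦ (0 : Fin k → F)) (v t 0) t
      rw [this]
      exact hasDerivAt_const _ _
    · ext1 j
      refine (Submodule.starProjection_apply_eq_zero_iff Wᗮ).2 ?_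
      rw [Submodule.orthogonal_orthogonal]
      exact Submodule.subset_span ⟨j, rfl⟩
  have ht₀ : t₀ ∈ Set.Ioo (t₀ - ε) (t₀ + ε) := by constructor <;> linarith
  filter_upwards [Ioo_mem_nhds ht₀.1 ht₀.2] with t ht
  exact le_antisymm (key _ ht₀ _ ht) (key _ ht _ ht₀)

/-- If the distribution spanned by `X` is invariant under the distribution spanned by `Z`, along
whose integral manifolds `h` is constant, then the image of the former under `dh` is constant
along curves tangent to the latter. -/
theorem eventually_span_fderiv_eq {k l : ℕ} {h : E → F} {X : Fin k → E → E} {Z : Fin l → E → E}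
    {Ω : Set E} {c : ℝ → E} {t₀ : ℝ} (hΩ : IsOpen Ω) (hcΩ : c t₀ ∈ Ω)
    (hh : ContDiffOn ℝ ∞ h Ω) (hX : ∀ j, ContDiffOn ℝ ∞ (X j) Ω)
    (hZ : ∀ a, ContDiffOn ℝ ∞ (Z a) Ω)
    (hXli : LinearIndependent ℝ fun j ↦ X j (c t₀)) (hZli : LinearIndependent ℝ fun a ↦ Z a (c t₀))
    (hhZ : ∀ a, ∀ u ∈ Ω, fderiv ℝ h u (Z a u) = 0)
    (hbr : ∀ a j, ∀ u ∈ Ω,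
      VectorField.lieBracket ℝ (Z a) (X j) u ∈ Submodule.span ℝ (Set.range fun i ↦ X i u))
    (hc : ContDiffAt ℝ ∞ c t₀)
    (hcZ : ∀ᶠ t in 𝓝 t₀, deriv c t ∈ Submodule.span ℝ (Set.range fun a ↦ Z a (c t))) :
    ∀ᶠ t in 𝓝 t₀, Submodule.span ℝ (Set.range fun j ↦ fderiv ℝ h (c t) (X j (c t))) =
      Submodule.span ℝ (Set.range fun j ↦ fderiv ℝ h (c t₀) (X j (c t₀))) := by
  have hΩc := hΩ.mem_nhds hcΩ
  have hcc : ContinuousAt c t₀ := hc.continuousAt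
  obtain ⟨cX, hcX0, hcX⟩ := exists_norm_le_of_linearIndependent
    (fun j ↦ ((hX j).contDiffAt hΩc).continuousAt) hXli
  obtain ⟨cZ, hcZ0, hcZ'⟩ := exists_norm_le_of_linearIndependent
    (fun a ↦ ((hZ a).contDiffAt hΩc).continuousAt) hZli
  have hdc : ContinuousAt (deriv c) t₀ := by
    have : ContDiffAt ℝ ∞ (fun t ↦ fderiv ℝ c t 1) t₀ :=
      (hc.fderiv_right (m := ∞) (by simp)).clm_apply contDiffAt_const
    exact this.continuousAt
  have hdcb : ∀ᶠ t in 𝓝 t₀, ‖deriv c t‖ < ‖deriv c t₀‖ + 1 :=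
    hdc.norm.eventually_lt continuousAt_const (by simp)
  have hbrb : ∀ᶠ t in 𝓝 t₀, ∀ a j, ‖VectorField.lieBracket ℝ (Z a) (X j) (c t)‖ <
      ‖VectorField.lieBracket ℝ (Z a) (X j) (c t₀)‖ + 1 := by
    refine Filter.eventually_all.2 fun a ↦ Filter.eventually_all.2 fun j ↦ ?_
    have h1 : ContinuousAt (VectorField.lieBracket ℝ (Z a) (X j)) (c t₀) := by
      have hZa := (hZ a).contDiffAt hΩc
      have hXa := (hX j).contDiffAt hΩc
      exact ((((hXa.fderiv_right (m := ∞) (by simp)).clm_apply hZa).sub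
        ((hZa.fderiv_right (m := ∞) (by simp)).clm_apply hXa)).continuousAt)
    exact (ContinuousAt.comp (f := c) h1 hcc).norm.eventually_lt continuousAt_const (by simp)
  -- a common bound for the brackets along the curve
  let β : ℝ := ∑ a, ∑ j, (‖VectorField.lieBracket ℝ (Z a) (X j) (c t₀)‖ + 1)
  have hβ : ∀ᶠ t in 𝓝 t₀, ∀ j, ∑ a, ‖VectorField.lieBracket ℝ (Z a) (X j) (c t)‖ ≤ β := by
    filter_upwards [hbrb] with t ht j
    refine Finset.sum_le_sum fun a _ ↦ (ht a j).le.trans ?_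
    exact Finset.single_le_sum
      (f := fun j ↦ ‖VectorField.lieBracket ℝ (Z a) (X j) (c t₀)‖ + 1)
      (fun i _ ↦ by positivity) (Finset.mem_univ j)
  refine eventually_span_eq_of_hasDerivAt
    (K := cX * (cZ * (‖deriv c t₀‖ + 1) * β)) ?_
  have hdiff : ∀ᶠ t in 𝓝 t₀, ContDiffAt ℝ 1 c t := (hc.of_le (by simp)).eventually (by simp)
  filter_upwards [hcc.eventually hcX, hcc.eventually hcZ', hdcb, hβ, hcc.eventually hΩc, hcZ, hdiff]
    with t ht1 ht2 ht3 ht4 ht5 ht6 ht7 j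
  obtain ⟨f, hf⟩ := (Submodule.mem_span_range_iff_exists_fun ℝ).1 ht6
  have hf' : ‖f‖ ≤ cZ * (‖deriv c t₀‖ + 1) := by
    refine (ht2 f).trans (mul_le_mul_of_nonneg_left ?_ hcZ0)
    rw [hf]
    exact ht3.le
  -- the derivative of `X j` along the curve, modulo the kernel of `dh`
  let η : E := ∑ a, f a • VectorField.lieBracket ℝ (Z a) (X j) (c t)
  have hη : η ∈ Submodule.span ℝ (Set.range fun i ↦ X i (c t)) :=
    Submodule.sum_mem _ fun a _ ↦ Submodule.smul_mem _ _ (hbr a j _ ht5)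
  have hηn : ‖η‖ ≤ cZ * (‖deriv c t₀‖ + 1) * β := by
    have h1 : ‖η‖ ≤ ‖f‖ * ∑ a, ‖VectorField.lieBracket ℝ (Z a) (X j) (c t)‖ := by
      rw [Finset.mul_sum]
      refine (norm_sum_le _ _).trans (Finset.sum_le_sum fun a _ ↦ ?_)
      rw [norm_smul]
      exact mul_le_mul_of_nonneg_right (norm_le_pi_norm f a) (norm_nonneg _)
    exact h1.trans (mul_le_mul hf' (ht4 j) (Finset.sum_nonneg fun _ _ ↦ norm_nonneg _)
      (by positivity))
  obtain ⟨b, hb⟩ := (Submodule.mem_span_range_iff_exists_fun ℝ).1 hη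
  refine ⟨b, ?_, ?_⟩
  · refine (ht1 b).trans (mul_le_mul_of_nonneg_left ?_ hcX0)
    rw [hb]
    exact hηn
  · have hφ : ContDiffAt ℝ ∞ (fun u ↦ fderiv ℝ h u (X j u)) (c t) :=
      ((hh.contDiffAt (hΩ.mem_nhds ht5)).fderiv_right (m := ∞) (by simp)).clm_apply
        ((hX j).contDiffAt (hΩ.mem_nhds ht5))
    have h1 := (hφ.differentiableAt (by simp)).hasFDerivAt.comp_hasDerivAt t
      (ht7.differentiableAt (by simp)).hasDerivAt
    have h2 : fderiv ℝ (fun u ↦ fderiv ℝ h u (X j u)) (c t) (deriv c t) =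
        ∑ i, b i • fderiv ℝ h (c t) (X i (c t)) := by
      rw [← hf, map_sum]
      simp_rw [map_smul]
      rw [Finset.sum_congr rfl fun a _ ↦ by
        rw [fderiv_fderiv_apply_eq_lieBracket hΩ hh (hX j) (hZ a) (hhZ a) ht5]]
      simp_rw [← map_smul, ← map_sum]
      exact congrArg _ hb.symm
    rw [h2] at h1
    exact h1

end Transport

/-! ### Maps and vector fields in charts -/

section Charts

variable {m : ℕ} {M : Type*} [TopologicalSpace M] [ChartedSpace (EuclideanSpace ℝ (Fin m)) M]
  {n : ℕ} {S : Type*} [TopologicalSpace S] [ChartedSpace (EuclideanSpace ℝ (Fin n)) S]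

/-- The image of `U` in the chart at `x₀`. -/
noncomputable def chartImage (x₀ : M) (U : Set M) : Set (EuclideanSpace ℝ (Fin m)) :=
  (extChartAt (𝓡 m) x₀).target ∩ (extChartAt (𝓡 m) x₀).symm ⁻¹' U

theorem isOpen_chartImage (x₀ : M) {U : Set M} (hU : IsOpen U) : IsOpen (chartImage (m := m) x₀ U) :=
  (continuousOn_extChartAt_symm x₀).isOpen_inter_preimage (isOpen_extChartAt_target x₀) hU

theorem mem_chartImage {x₀ x : M} {U : Set M} (hx : x ∈ (extChartAt (𝓡 m) x₀).source)
    (hxU : x ∈ U) : extChartAt (𝓡 m) x₀ x ∈ chartImage x₀ U :=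
  ⟨(extChartAt (𝓡 m) x₀).map_source hx, by
    rwa [Set.mem_preimage, (extChartAt (𝓡 m) x₀).left_inv hx]⟩

/-- A map `f : M → S` written in the charts at `x₀` and `s₀`. -/
noncomputable def coordMap (x₀ : M) (s₀ : S) (f : M → S) (u : EuclideanSpace ℝ (Fin m)) :
    EuclideanSpace ℝ (Fin n) :=
  extChartAt (𝓡 n) s₀ (f ((extChartAt (𝓡 m) x₀).symm u))

/-- A vector field written in the chart at `x₀`. -/
noncomputable def coordField (x₀ : M) (X : ∀ x : M, TangentSpace (𝓡 m) x)
    (u : EuclideanSpace ℝ (Fin m)) : EuclideanSpace ℝ (Fin m) :=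
  chartDeriv x₀ ((extChartAt (𝓡 m) x₀).symm u) (X ((extChartAt (𝓡 m) x₀).symm u))

theorem coordField_mem_span {x₀ : M} {k : ℕ} {X : Fin k → ∀ x : M, TangentSpace (𝓡 m) x}
    {Y : ∀ x : M, TangentSpace (𝓡 m) x} {u : EuclideanSpace ℝ (Fin m)}
    (hY : Y ((extChartAt (𝓡 m) x₀).symm u) ∈
      Submodule.span ℝ (Set.range fun j ↦ X j ((extChartAt (𝓡 m) x₀).symm u))) :
    coordField x₀ Y u ∈ Submodule.span ℝ (Set.range fun j ↦ coordField x₀ (X j) u) := by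
  have h := Submodule.mem_map_of_mem
    (f := (chartDeriv x₀ ((extChartAt (𝓡 m) x₀).symm u)).toLinearMap) hY
  rw [Submodule.map_span, ← Set.range_comp] at h
  exact h

theorem mlieBracket_eq_lieBracket {E : Type*} [NormedAddCommGroup E] [NormedSpace ℝ E] (V W : E → E)
    (u : E) : VectorField.mlieBracket 𝓘(ℝ, E) V W u = VectorField.lieBracket ℝ V W u := by
  have h1 := congrFun (VectorField.mlieBracketWithin_univ (I := 𝓘(ℝ, E)) (V := V) (W := W)) u
  have h2 := congrFun (VectorField.mlieBracketWithin_eq_lieBracketWithin (V := V) (W := W)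
    (𝕜 := ℝ) (s := Set.univ)) u
  exact h1.symm.trans (h2.trans (congrFun VectorField.lieBracketWithin_univ u))

variable [IsManifold (𝓡 m) ∞ M] [IsManifold (𝓡 n) ∞ S]

theorem mdifferentiableAt_extChartAt_symm (x₀ : M) {u : EuclideanSpace ℝ (Fin m)}
    (hu : u ∈ (extChartAt (𝓡 m) x₀).target) :
    MDifferentiableAt 𝓘(ℝ, EuclideanSpace ℝ (Fin m)) (𝓡 m) (extChartAt (𝓡 m) x₀).symm u :=
  ((contMDiffOn_extChartAt_symm (n := ∞) x₀).contMDiffAt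
    ((isOpen_extChartAt_target x₀).mem_nhds hu)).mdifferentiableAt (by simp)

/-- The differential of the inverse of the chart at `x₀`, from the model space to the tangent
space at `x`. It is defined as an inverse, so that no transport between the tangent spaces at `x` and at
its image under the chart and back is needed; it is meaningful on the domain of the chart only. -/
noncomputable def chartSymmDeriv (x₀ x : M) : EuclideanSpace ℝ (Fin m) →L[ℝ] TangentSpace (𝓡 m) x :=
  (chartDeriv x₀ x).inverse

theorem isInvertible_chartDeriv {x₀ x : M} (hx : x ∈ (extChartAt (𝓡 m) x₀).source) :
    (chartDeriv (n := m) x₀ x).IsInvertible :=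
  have : IsManifold (𝓡 m) 1 M := IsManifold.of_le (n := ∞) (by simp)
  isInvertible_mfderiv_extChartAt hx

theorem chartDeriv_chartSymmDeriv {x₀ x : M} (hx : x ∈ (extChartAt (𝓡 m) x₀).source)
    (v : EuclideanSpace ℝ (Fin m)) : chartDeriv x₀ x (chartSymmDeriv x₀ x v) = v :=
  DFunLike.congr_fun (isInvertible_chartDeriv hx).self_comp_inverse v

theorem chartSymmDeriv_chartDeriv {x₀ x : M} (hx : x ∈ (extChartAt (𝓡 m) x₀).source)
    (v : TangentSpace (𝓡 m) x) : chartSymmDeriv x₀ x (chartDeriv x₀ x v) = v :=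
  DFunLike.congr_fun (isInvertible_chartDeriv hx).inverse_comp_self v

theorem chartDeriv_injective {x₀ x : M} (hx : x ∈ (extChartAt (𝓡 m) x₀).source) :
    Function.Injective (chartDeriv (n := m) x₀ x) :=
  Function.LeftInverse.injective (chartSymmDeriv_chartDeriv hx)

theorem mfderiv_extChartAt_symm (x₀ : M) {u : EuclideanSpace ℝ (Fin m)}
    (hu : u ∈ (extChartAt (𝓡 m) x₀).target) :
    mfderiv 𝓘(ℝ, EuclideanSpace ℝ (Fin m)) (𝓡 m) (extChartAt (𝓡 m) x₀).symm u =
      chartSymmDeriv x₀ ((extChartAt (𝓡 m) x₀).symm u) := by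
  have : IsManifold (𝓡 m) 1 M := IsManifold.of_le (n := ∞) (by simp)
  have h := mfderiv_extChartAt_comp_mfderivWithin_extChartAt_symm (I := 𝓡 m) (x := x₀) hu
  rw [modelWithCornersSelf_coe, Set.range_id, mfderivWithin_univ] at h
  have hx : (extChartAt (𝓡 m) x₀).symm u ∈ (extChartAt (𝓡 m) x₀).source :=
    (extChartAt (𝓡 m) x₀).map_target hu
  ext1 v
  apply chartDeriv_injective hx
  exact (DFunLike.congr_fun h v).trans (chartDeriv_chartSymmDeriv hx v).symm

theorem contDiffOn_coordMap (x₀ : M) (s₀ : S) {f : M → S} {U : Set M}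
    (hf : ContMDiffOn (𝓡 m) (𝓡 n) ∞ f U)
    (hfU : ∀ x ∈ U, f x ∈ (extChartAt (𝓡 n) s₀).source) :
    ContDiffOn ℝ ∞ (coordMap (m := m) (n := n) x₀ s₀ f) (chartImage x₀ U) := by
  rw [← contMDiffOn_iff_contDiffOn]
  have h1 : ContMDiffOn (𝓡 n) 𝓘(ℝ, EuclideanSpace ℝ (Fin n)) ∞ (extChartAt (𝓡 n) s₀)
      (chartAt (EuclideanSpace ℝ (Fin n)) s₀).source := contMDiffOn_extChartAt
  have h2 := (contMDiffOn_extChartAt_symm (I := 𝓡 m) (n := ∞) x₀).mono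
    (Set.inter_subset_left : chartImage x₀ U ⊆ _)
  refine h1.comp (hf.comp h2 fun u hu ↦ hu.2) fun u hu ↦ ?_
  have := hfU _ hu.2
  rwa [extChartAt_source] at this

theorem fderiv_coordMap (x₀ : M) (s₀ : S) {f : M → S} {u : EuclideanSpace ℝ (Fin m)}
    (hu : u ∈ (extChartAt (𝓡 m) x₀).target)
    (hf : MDifferentiableAt (𝓡 m) (𝓡 n) f ((extChartAt (𝓡 m) x₀).symm u))
    (hfu : f ((extChartAt (𝓡 m) x₀).symm u) ∈ (extChartAt (𝓡 n) s₀).source)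
    (v : EuclideanSpace ℝ (Fin m)) :
    fderiv ℝ (coordMap x₀ s₀ f) u v =
      chartDeriv s₀ (f ((extChartAt (𝓡 m) x₀).symm u))
        (mfderiv (𝓡 m) (𝓡 n) f ((extChartAt (𝓡 m) x₀).symm u)
          (chartSymmDeriv x₀ ((extChartAt (𝓡 m) x₀).symm u) v)) := by
  have : IsManifold (𝓡 n) 1 S := IsManifold.of_le (n := ∞) (by simp)
  have h1 : MDifferentiableAt (𝓡 n) 𝓘(ℝ, EuclideanSpace ℝ (Fin n)) (extChartAt (𝓡 n) s₀)
      (f ((extChartAt (𝓡 m) x₀).symm u)) :=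
    mdifferentiableAt_extChartAt (by rwa [extChartAt_source] at hfu)
  have h2 := mdifferentiableAt_extChartAt_symm x₀ hu
  have h3 := h1.hasMFDerivAt.comp u (hf.hasMFDerivAt.comp u h2.hasMFDerivAt)
  rw [mfderiv_extChartAt_symm x₀ hu] at h3
  have h4 : HasFDerivAt (coordMap x₀ s₀ f)
      (chartDeriv s₀ (f ((extChartAt (𝓡 m) x₀).symm u)) ∘L
        (mfderiv (𝓡 m) (𝓡 n) f ((extChartAt (𝓡 m) x₀).symm u) ∘L
          chartSymmDeriv x₀ ((extChartAt (𝓡 m) x₀).symm u)) :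
        EuclideanSpace ℝ (Fin m) →L[ℝ] EuclideanSpace ℝ (Fin n)) u := h3.hasFDerivAt
  rw [h4.fderiv]
  rfl

theorem coordField_eq_mpullback (x₀ : M) (X : ∀ x : M, TangentSpace (𝓡 m) x)
    {u : EuclideanSpace ℝ (Fin m)} (hu : u ∈ (extChartAt (𝓡 m) x₀).target) :
    coordField x₀ X u = VectorField.mpullback 𝓘(ℝ, EuclideanSpace ℝ (Fin m)) (𝓡 m)
      (extChartAt (𝓡 m) x₀).symm X u := by
  rw [VectorField.mpullback_apply, mfderiv_extChartAt_symm x₀ hu]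
  have hx : (extChartAt (𝓡 m) x₀).symm u ∈ (extChartAt (𝓡 m) x₀).source :=
    (extChartAt (𝓡 m) x₀).map_target hu
  exact (DFunLike.congr_fun (isInvertible_chartDeriv hx).inverse_inverse _).symm

theorem isInvertible_mfderiv_extChartAt_symm (x₀ : M) {u : EuclideanSpace ℝ (Fin m)}
    (hu : u ∈ (extChartAt (𝓡 m) x₀).target) :
    (mfderiv 𝓘(ℝ, EuclideanSpace ℝ (Fin m)) (𝓡 m) (extChartAt (𝓡 m) x₀).symm u).IsInvertible := by
  rw [mfderiv_extChartAt_symm x₀ hu]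
  exact (isInvertible_chartDeriv ((extChartAt (𝓡 m) x₀).map_target hu)).inverse

theorem contDiffOn_coordField (x₀ : M) {X : ∀ x : M, TangentSpace (𝓡 m) x} {U : Set M}
    (hU : IsOpen U) (hX : SmoothFieldOn X U) :
    ContDiffOn ℝ ∞ (coordField x₀ X) (chartImage x₀ U) := by
  have : IsManifold (𝓡 m) (∞ + 1) M := inferInstanceAs (IsManifold (𝓡 m) ∞ M)
  intro u hu
  have h1 := ContMDiffAt.mpullback_vectorField_preimage (m := ∞) (n := ∞) (V := X)
    (f := (extChartAt (𝓡 m) x₀).symm) (x₀ := u) (I := 𝓘(ℝ, EuclideanSpace ℝ (Fin m)))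
    (hX.contMDiffAt (hU.mem_nhds hu.2))
    ((contMDiffOn_extChartAt_symm x₀).contMDiffAt ((isOpen_extChartAt_target x₀).mem_nhds hu.1))
    (isInvertible_mfderiv_extChartAt_symm x₀ hu.1) (by simp)
  have h2 := contMDiffAt_vectorSpace_iff_contDiffAt.1 h1
  refine ContDiffAt.contDiffWithinAt (h2.congr_of_eventuallyEq ?_)
  filter_upwards [(isOpen_extChartAt_target x₀).mem_nhds hu.1] with w hw
  exact coordField_eq_mpullback x₀ X hw

theorem lieBracket_coordField (x₀ : M) {X Y : ∀ x : M, TangentSpace (𝓡 m) x} {U : Set M}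
    (hU : IsOpen U) (hX : SmoothFieldOn X U) (hY : SmoothFieldOn Y U)
    {u : EuclideanSpace ℝ (Fin m)} (hu : u ∈ chartImage x₀ U) :
    VectorField.lieBracket ℝ (coordField x₀ X) (coordField x₀ Y) u =
      coordField x₀ (VectorField.mlieBracket (𝓡 m) X Y) u := by
  have : IsManifold (𝓡 m) (minSmoothness ℝ 3) M :=
    IsManifold.of_le (n := ∞) (by simpa using ENat.LEInfty.out)
  have hUu := hU.mem_nhds hu.2
  have h1 := VectorField.mpullback_mlieBracket (n := ∞) (V := X) (W := Y)
    (f := (extChartAt (𝓡 m) x₀).symm) (x₀ := u) (I := 𝓘(ℝ, EuclideanSpace ℝ (Fin m)))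
    ((hX.contMDiffAt hUu).mdifferentiableAt (by simp))
    ((hY.contMDiffAt hUu).mdifferentiableAt (by simp))
    ((contMDiffOn_extChartAt_symm x₀).contMDiffAt ((isOpen_extChartAt_target x₀).mem_nhds hu.1))
    (by simpa using ENat.LEInfty.out)
  rw [coordField_eq_mpullback x₀ _ hu.1, h1]
  refine Eq.trans ?_ (mlieBracket_eq_lieBracket _ _ _).symm
  refine Filter.EventuallyEq.lieBracket_vectorField_eq ?_ ?_
  all_goals
    filter_upwards [(isOpen_extChartAt_target x₀).mem_nhds hu.1] with w hw
    exact coordField_eq_mpullback x₀ _ hw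

end Charts

/-! ### Images of subspaces of tangent spaces -/

section MapAt

variable {m : ℕ} {M : Type*} [TopologicalSpace M] [ChartedSpace (EuclideanSpace ℝ (Fin m)) M]
  {n : ℕ} {S : Type*} [TopologicalSpace S] [ChartedSpace (EuclideanSpace ℝ (Fin n)) S]
  {k : ℕ} {N : Type*} [TopologicalSpace N] [ChartedSpace (EuclideanSpace ℝ (Fin k)) N]

/-- The image of a subspace `W` of the tangent space at `x` under the differential of `f`,
together with its base point `f x`. -/
noncomputable def mapAt (f : M → S) (x : M) (W : Submodule ℝ (TangentSpace (𝓡 m) x)) :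
    Σ γ : S, Submodule ℝ (TangentSpace (𝓡 n) γ) :=
  ⟨f x, W.map (mfderiv (𝓡 m) (𝓡 n) f x).toLinearMap⟩

/-- All tangent spaces of `S` being copies of the model space, subspaces at equal points may be
compared there. -/
theorem sigma_mk_eq {a b : S} (h : a = b) (V W : Submodule ℝ (EuclideanSpace ℝ (Fin n)))
    (hVW : V = W) : (⟨a, V⟩ : Σ γ : S, Submodule ℝ (TangentSpace (𝓡 n) γ)) = ⟨b, W⟩ := by
  subst h hVW
  rfl

theorem mapAt_congr {f g : M → S} {x : M} (h : f =ᶠ[𝓝 x] g)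
    (W : Submodule ℝ (TangentSpace (𝓡 m) x)) : mapAt (n := n) f x W = mapAt (n := n) g x W :=
  sigma_mk_eq h.self_of_nhds _ _ (congrArg
    (fun A : TangentSpace (𝓡 m) x →L[ℝ] EuclideanSpace ℝ (Fin n) ↦ W.map A.toLinearMap)
    (h.mfderiv_eq (I := 𝓡 m) (I' := 𝓡 n)))

theorem mapAt_comp {f : M → S} {g : S → N} {x : M}
    (hg : MDifferentiableAt (𝓡 n) (𝓡 k) g (f x)) (hf : MDifferentiableAt (𝓡 m) (𝓡 n) f x)
    (W : Submodule ℝ (TangentSpace (𝓡 m) x)) :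
    mapAt (n := k) (g ∘ f) x W =
      mapAt (n := k) g (f x) (W.map (mfderiv (𝓡 m) (𝓡 n) f x).toLinearMap) := by
  refine sigma_mk_eq rfl _ _ ?_
  rw [mfderiv_comp x hg hf]
  exact Submodule.map_comp _ _ W

theorem mapAt_id (x : M) (W : Submodule ℝ (TangentSpace (𝓡 m) x)) :
    mapAt (n := m) id x W = ⟨x, W⟩ := by
  refine sigma_mk_eq rfl _ _ ?_
  rw [mfderiv_id]
  exact Submodule.map_id W

/-- The transport along an equality of base points used in the definition of `pushforward`. -/
theorem eqRec_eq_of_sigma_eq {γ γ' : S} (h : γ = γ') (W : Submodule ℝ (TangentSpace (𝓡 n) γ))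
    (W' : Submodule ℝ (TangentSpace (𝓡 n) γ'))
    (hW : (⟨γ, W⟩ : Σ γ : S, Submodule ℝ (TangentSpace (𝓡 n) γ)) = ⟨γ', W'⟩) : h ▸ W = W' := by
  subst h
  exact eq_of_heq (Sigma.mk.inj hW).2

theorem FlagBundle.eq_of_sigma_eq {Λ Θ : FlagBundle n S} (hb : Λ.base = Θ.base)
    (h : ∀ i, (⟨Λ.base, Λ.flag i⟩ : Σ γ : S, Submodule ℝ (TangentSpace (𝓡 n) γ)) =
      ⟨Θ.base, Θ.flag i⟩) : Λ = Θ := by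
  obtain ⟨a, V⟩ := Λ
  obtain ⟨b, W⟩ := Θ
  obtain rfl : a = b := hb
  congr 1
  ext1 i
  exact eq_of_heq (Sigma.mk.inj (h i)).2

theorem FlagBundle.sigma_eq {Λ Θ : FlagBundle n S} (h : Λ = Θ) (i : ℤ) :
    (⟨Λ.base, Λ.flag i⟩ : Σ γ : S, Submodule ℝ (TangentSpace (𝓡 n) γ)) =
      ⟨Θ.base, Θ.flag i⟩ := by
  rw [h]

theorem FlagBundle.push_congr {ψ ψ' : S → N} {Λ : FlagBundle n S} (h : ψ =ᶠ[𝓝 Λ.base] ψ') :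
    Λ.push (n₁ := k) ψ = Λ.push (n₁ := k) ψ' :=
  FlagBundle.eq_of_sigma_eq h.self_of_nhds fun i ↦ mapAt_congr h (Λ.flag i)

theorem FlagBundle.push_id (Λ : FlagBundle n S) : Λ.push (n₁ := n) id = Λ :=
  FlagBundle.eq_of_sigma_eq rfl fun i ↦ mapAt_id Λ.base (Λ.flag i)

theorem FlagBundle.push_push {l : ℕ} {P : Type*} [TopologicalSpace P]
    [ChartedSpace (EuclideanSpace ℝ (Fin l)) P] {ψ : S → N} {χ : N → P} {Λ : FlagBundle n S}
    (hχ : MDifferentiableAt (𝓡 k) (𝓡 l) χ (ψ Λ.base))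
    (hψ : MDifferentiableAt (𝓡 n) (𝓡 k) ψ Λ.base) :
    (Λ.push (n₁ := k) ψ).push (n₁ := l) χ = Λ.push (n₁ := l) (χ ∘ ψ) :=
  FlagBundle.eq_of_sigma_eq rfl fun i ↦ (mapAt_comp hχ hψ (Λ.flag i)).symm

end MapAt

/-! ### Local factorization and invariance along the leaves -/

section LeafSpace

variable {m : ℕ} {M : Type*} [TopologicalSpace M] [ChartedSpace (EuclideanSpace ℝ (Fin m)) M]
  {n : ℕ} {S : Type*} [TopologicalSpace S] [ChartedSpace (EuclideanSpace ℝ (Fin n)) S]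
  {k : ℕ} {N : Type*} [TopologicalSpace N] [ChartedSpace (EuclideanSpace ℝ (Fin k)) N]

/-- All points of a curve tangent to `C` lie on one leaf. -/
theorem sameLeaf_of_tangent {C : SubspaceField m M} {c : ℝ → M}
    (hc : ContMDiff 𝓘(ℝ, ℝ) (𝓡 m) ∞ c)
    (hcC : ∀ t, mfderiv 𝓘(ℝ, ℝ) (𝓡 m) c t (1 : ℝ) ∈ C (c t)) (t₀ t₁ : ℝ) :
    SameLeaf C (c t₀) (c t₁) := by
  refine Relation.ReflTransGen.single ⟨fun s ↦ c (t₀ + s * (t₁ - t₀)), ?_, by simp, by simp, ?_⟩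
  · refine hc.comp (ContDiff.contMDiff ?_)
    fun_prop
  · intro s
    have h1 : HasDerivAt (fun s : ℝ ↦ t₀ + s * (t₁ - t₀)) (t₁ - t₀) s := by
      simpa using ((hasDerivAt_id s).mul_const (t₁ - t₀)).const_add t₀
    have h2 := ((hc.mdifferentiableAt (x := t₀ + s * (t₁ - t₀)) (by simp)).hasMFDerivAt).comp s
      h1.hasFDerivAt.hasMFDerivAt
    have h3 : mfderiv 𝓘(ℝ, ℝ) (𝓡 m) (fun s : ℝ ↦ c (t₀ + s * (t₁ - t₀))) s (1 : ℝ) =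
        mfderiv 𝓘(ℝ, ℝ) (𝓡 m) c (t₀ + s * (t₁ - t₀)) ((t₁ - t₀ : ℝ) • (1 : ℝ)) := by
      refine (DFunLike.congr_fun h2.mfderiv (1 : ℝ)).trans ?_
      refine congrArg (mfderiv 𝓘(ℝ, ℝ) (𝓡 m) c (t₀ + s * (t₁ - t₀))) ?_
      change (ContinuousLinearMap.toSpanSingleton ℝ (t₁ - t₀)) (1 : ℝ) = (t₁ - t₀ : ℝ) • (1 : ℝ)
      simp
    have h4 : mfderiv 𝓘(ℝ, ℝ) (𝓡 m) c (t₀ + s * (t₁ - t₀)) ((t₁ - t₀ : ℝ) • (1 : ℝ)) =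
        (t₁ - t₀) • mfderiv 𝓘(ℝ, ℝ) (𝓡 m) c (t₀ + s * (t₁ - t₀)) (1 : ℝ) :=
      (mfderiv 𝓘(ℝ, ℝ) (𝓡 m) c (t₀ + s * (t₁ - t₀))).map_smul _ _
    rw [h3]
    exact h4 ▸ Submodule.smul_mem _ _ (hcC _)

variable [IsManifold (𝓡 m) ∞ M] [IsManifold (𝓡 n) ∞ S] [IsManifold (𝓡 k) ∞ N]

/-- A map that is constant along the fibres of a submersion factors locally through it. -/
theorem exists_factor_of_ker_mfderiv_le {π : M → S} {f : M → N} {U : Set M} {x : M}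
    (hπ : ContMDiff (𝓡 m) (𝓡 n) ∞ π) (hπx : Function.Surjective (mfderiv (𝓡 m) (𝓡 n) π x))
    (hU : IsOpen U) (hx : x ∈ U) (hf : ContMDiffOn (𝓡 m) (𝓡 k) ∞ f U)
    (hker : ∀ y ∈ U, ∀ v, mfderiv (𝓡 m) (𝓡 n) π y v = 0 → mfderiv (𝓡 m) (𝓡 k) f y v = 0) :
    ∃ (V : Set M) (g : S → N), IsOpen V ∧ x ∈ V ∧ V ⊆ U ∧ IsOpen (π '' V) ∧
      ContMDiffOn (𝓡 n) (𝓡 k) ∞ g (π '' V) ∧ ∀ y ∈ V, f y = g (π y) := by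
  let φ := extChartAt (𝓡 m) x
  let χ := extChartAt (𝓡 n) (π x)
  let θ := extChartAt (𝓡 k) (f x)
  let U' : Set M := (φ.source ∩ π ⁻¹' χ.source) ∩ (U ∩ f ⁻¹' θ.source)
  have hU' : IsOpen U' := ((isOpen_extChartAt_source x).inter
    ((isOpen_extChartAt_source (π x)).preimage hπ.continuous)).inter
    (hf.continuousOn.isOpen_inter_preimage hU (isOpen_extChartAt_source (f x)))
  have hxφ : x ∈ φ.source := mem_extChartAt_source x
  have hxU' : x ∈ U' := ⟨⟨hxφ, mem_extChartAt_source (π x)⟩, hx, mem_extChartAt_source (f x)⟩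
  have hΩ : IsOpen (chartImage (m := m) x U') := isOpen_chartImage x hU'
  have hmemU' : ∀ u ∈ chartImage (m := m) x U', φ.symm u ∈ U' := fun u hu ↦ hu.2
  have hfd : ∀ y ∈ U, MDifferentiableAt (𝓡 m) (𝓡 k) f y := fun y hy ↦
    (hf.contMDiffAt (hU.mem_nhds hy)).mdifferentiableAt (by simp)
  have hπd : ∀ y, MDifferentiableAt (𝓡 m) (𝓡 n) π y := fun y ↦ hπ.mdifferentiableAt (by simp)
  have hu₀ : φ x ∈ chartImage x U' := mem_chartImage hxφ hxU'
  have hφx : φ.symm (φ x) = x := φ.left_inv hxφ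
  have hsurj : Function.Surjective
      (fderiv ℝ (coordMap (m := m) (n := n) x (π x) π) (φ x)) := by
    intro w
    have hxs : φ.symm (φ x) ∈ φ.source := by rwa [hφx]
    have hχs : π (φ.symm (φ x)) ∈ χ.source := by rw [hφx]; exact mem_extChartAt_source _
    have hs : Function.Surjective (mfderiv (𝓡 m) (𝓡 n) π (φ.symm (φ x))) := by rwa [hφx]
    obtain ⟨v, hv⟩ := hs (chartSymmDeriv (π x) (π (φ.symm (φ x))) w)
    refine ⟨chartDeriv x (φ.symm (φ x)) v, ?_⟩
    refine (fderiv_coordMap x (π x) hu₀.1 (hπd _) hχs _).trans ?_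
    change chartDeriv (π x) (π (φ.symm (φ x))) (mfderiv (𝓡 m) (𝓡 n) π (φ.symm (φ x))
      (chartSymmDeriv x (φ.symm (φ x)) (chartDeriv x (φ.symm (φ x)) v))) = w
    rw [chartSymmDeriv_chartDeriv hxs, hv, chartDeriv_chartSymmDeriv hχs]
  obtain ⟨V, g, hV, h1, h2, h3, h4, h5⟩ := exists_factor_of_ker_le hΩ hu₀
    (contDiffOn_coordMap x (π x) hπ.contMDiffOn fun y hy ↦ hy.1.2)
    (contDiffOn_coordMap x (f x) (hf.mono fun y hy ↦ hy.2.1) fun y hy ↦ hy.2.2) hsurj (by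
      intro u hu v hv
      have hu' := hmemU' u hu
      rw [fderiv_coordMap x (f x) hu.1 (hfd _ hu'.2.1) hu'.2.2]
      rw [fderiv_coordMap x (π x) hu.1 (hπd _) hu'.1.2] at hv
      have h0 := chartDeriv_injective hu'.1.2 (hv.trans (map_zero _).symm)
      exact (congrArg _ (hker _ hu'.2.1 _ h0)).trans (map_zero _))
  have hhχ : ∀ u ∈ V, χ.symm (coordMap x (π x) π u) = π (φ.symm u) := fun u hu ↦
    χ.left_inv (hmemU' u (h2 hu)).1.2
  have hVφ : ∀ y ∈ φ.source ∩ φ ⁻¹' V, φ.symm (φ y) = y := fun y hy ↦ φ.left_inv hy.1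
  have himage : π '' (φ.source ∩ φ ⁻¹' V) = χ.source ∩ χ ⁻¹' (coordMap x (π x) π '' V) := by
    ext s
    constructor
    · rintro ⟨y, hy, rfl⟩
      have h6 := (hmemU' _ (h2 hy.2)).1.2
      rw [hVφ y hy] at h6
      refine ⟨h6, φ y, hy.2, ?_⟩
      change χ (π (φ.symm (φ y))) = χ (π y)
      rw [hVφ y hy]
    · rintro ⟨hs, u, hu, hus⟩
      have hut : u ∈ φ.target := (h2 hu).1
      refine ⟨φ.symm u, ⟨φ.map_target hut, ?_⟩, ?_⟩
      · change φ (φ.symm u) ∈ V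
        rwa [φ.right_inv hut]
      · rw [← hhχ u hu, hus]
        exact χ.left_inv hs
  refine ⟨φ.source ∩ φ ⁻¹' V, fun s ↦ θ.symm (g (χ s)), ?_, ⟨hxφ, h1⟩, ?_, ?_, ?_, ?_⟩
  · exact (continuousOn_extChartAt x).isOpen_inter_preimage (isOpen_extChartAt_source x) hV
  · intro y hy
    have h6 := (hmemU' _ (h2 hy.2)).2.1
    rwa [hVφ y hy] at h6
  · rw [himage]
    exact (continuousOn_extChartAt _).isOpen_inter_preimage (isOpen_extChartAt_source _) h3
  · rw [himage]
    have hχ : ContMDiffOn (𝓡 n) 𝓘(ℝ, EuclideanSpace ℝ (Fin n)) ∞ χ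
        (chartAt (EuclideanSpace ℝ (Fin n)) (π x)).source := contMDiffOn_extChartAt
    rw [← extChartAt_source (𝓡 n)] at hχ
    refine (contMDiffOn_extChartAt_symm (f x)).comp
      (h4.contMDiffOn.comp (hχ.mono Set.inter_subset_left) fun s hs ↦ hs.2) ?_
    rintro s ⟨-, u, hu, hus⟩
    change g (χ s) ∈ θ.target
    rw [← hus, ← h5 u hu]
    exact θ.map_source (hmemU' u (h2 hu)).2.2
  · intro y hy
    have h6 := (hmemU' _ (h2 hy.2)).2.2
    have h7 := h5 _ hy.2
    have h8 : coordMap x (f x) f (φ y) = θ (f y) := by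
      change θ (f (φ.symm (φ y))) = _
      rw [hVφ y hy]
    have h9 : coordMap x (π x) π (φ y) = χ (π y) := by
      change χ (π (φ.symm (φ y))) = _
      rw [hVφ y hy]
    rw [hVφ y hy] at h6
    change f y = θ.symm (g (χ (π y)))
    rw [← h9, ← h7, h8]
    exact (θ.left_inv h6).symm

theorem linearIndependent_coordField {x₀ : M} {X : Fin k → ∀ x : M, TangentSpace (𝓡 m) x}
    {u : EuclideanSpace ℝ (Fin m)} (hu : u ∈ (extChartAt (𝓡 m) x₀).target)
    (hX : LinearIndependent ℝ fun j ↦ X j ((extChartAt (𝓡 m) x₀).symm u)) :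
    LinearIndependent ℝ fun j ↦ coordField x₀ (X j) u :=
  hX.map' (chartDeriv x₀ ((extChartAt (𝓡 m) x₀).symm u)).toLinearMap
    (LinearMap.ker_eq_bot.2 (chartDeriv_injective ((extChartAt (𝓡 m) x₀).map_target hu)))

theorem fderiv_coordMap_coordField (x₀ : M) (s₀ : S) {π : M → S}
    (X : ∀ x : M, TangentSpace (𝓡 m) x) {u : EuclideanSpace ℝ (Fin m)}
    (hu : u ∈ (extChartAt (𝓡 m) x₀).target)
    (hπ : MDifferentiableAt (𝓡 m) (𝓡 n) π ((extChartAt (𝓡 m) x₀).symm u))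
    (hπu : π ((extChartAt (𝓡 m) x₀).symm u) ∈ (extChartAt (𝓡 n) s₀).source) :
    fderiv ℝ (coordMap x₀ s₀ π) u (coordField x₀ X u) =
      chartDeriv s₀ (π ((extChartAt (𝓡 m) x₀).symm u))
        (mfderiv (𝓡 m) (𝓡 n) π ((extChartAt (𝓡 m) x₀).symm u)
          (X ((extChartAt (𝓡 m) x₀).symm u))) := by
  rw [fderiv_coordMap x₀ s₀ hu hπ hπu, coordField,
    chartSymmDeriv_chartDeriv ((extChartAt (𝓡 m) x₀).map_target hu)]

/-- Subspaces of tangent spaces at the same point are equal if they have the same image in a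
chart. -/
theorem sigma_eq_of_map_chartDeriv_eq (γ₀ : S)
    (a b : Σ γ : S, Submodule ℝ (TangentSpace (𝓡 n) γ)) (h : a.1 = b.1)
    (hb : b.1 ∈ (extChartAt (𝓡 n) γ₀).source)
    (hmap : a.2.map (chartDeriv γ₀ a.1).toLinearMap = b.2.map (chartDeriv γ₀ b.1).toLinearMap) :
    a = b := by
  obtain ⟨γ, W⟩ := a
  obtain ⟨γ', W'⟩ := b
  obtain rfl : γ = γ' := h
  exact congrArg (Sigma.mk γ) (Submodule.map_injective_of_injective
    (f := (chartDeriv γ₀ γ).toLinearMap) (chartDeriv_injective hb) hmap)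

/-- If `[C, D] ⊆ D`, then `π_* D` is locally constant along curves tangent to `C`. -/
theorem eventually_mapAt_eq {C D : SubspaceField m M} (hC : IsDistribution C)
    (hD : IsDistribution D) (hCD : BracketLE C D D) {π : M → S}
    (hπ : IsLeafSpace (n := n) C π) {c : ℝ → M} (hc : ContMDiff 𝓘(ℝ, ℝ) (𝓡 m) ∞ c)
    (hcC : ∀ t, mfderiv 𝓘(ℝ, ℝ) (𝓡 m) c t (1 : ℝ) ∈ C (c t)) (t₀ : ℝ) :
    ∀ᶠ t in 𝓝 t₀, mapAt (n := n) π (c t) (D (c t)) =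
      mapAt (n := n) π (c t₀) (D (c t₀)) := by
  obtain ⟨k, X, U₁, hU₁, hp₁, hX, hXD⟩ := hD (c t₀)
  obtain ⟨l, Z, U₂, hU₂, hp₂, hZ, hZC⟩ := hC (c t₀)
  set p := c t₀ with hp
  let φ := extChartAt (𝓡 m) p
  let χ := extChartAt (𝓡 n) (π p)
  let U : Set M := (φ.source ∩ π ⁻¹' χ.source) ∩ (U₁ ∩ U₂)
  have hU : IsOpen U := ((isOpen_extChartAt_source p).inter
    ((isOpen_extChartAt_source (π p)).preimage hπ.smooth.continuous)).inter (hU₁.inter hU₂)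
  have hpφ : p ∈ φ.source := mem_extChartAt_source p
  have hpU : p ∈ U := ⟨⟨hpφ, mem_extChartAt_source (π p)⟩, hp₁, hp₂⟩
  have hXU : ∀ j, SmoothFieldOn (X j) U := fun j ↦ (hX j).mono fun y hy ↦ hy.2.1
  have hZU : ∀ j, SmoothFieldOn (Z j) U := fun j ↦ (hZ j).mono fun y hy ↦ hy.2.2
  have hπd : ∀ y, MDifferentiableAt (𝓡 m) (𝓡 n) π y := fun y ↦
    hπ.smooth.mdifferentiableAt (by simp)
  have hΩ : IsOpen (chartImage (m := m) p U) := isOpen_chartImage p hU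
  have hpΩ : φ p ∈ chartImage (m := m) p U := mem_chartImage hpφ hpU
  have hmemU : ∀ u ∈ chartImage (m := m) p U, φ.symm u ∈ U := fun u hu ↦ hu.2
  have hcU : ∀ᶠ t in 𝓝 t₀, c t ∈ U := hc.continuous.continuousAt.eventually (hU.mem_nhds hpU)
  have hφd : ∀ y ∈ φ.source, ContMDiffAt (𝓡 m) 𝓘(ℝ, EuclideanSpace ℝ (Fin m)) ∞ φ y := by
    intro y hy
    exact contMDiffAt_extChartAt' (by rwa [← extChartAt_source (𝓡 m)])
  -- the image of `D` under the differential of `π`, in coordinates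
  have himage : ∀ u ∈ chartImage (m := m) p U, ∀ y, φ.symm u = y →
      Submodule.span ℝ (Set.range fun j ↦
        fderiv ℝ (coordMap p (π p) π) u (coordField p (X j) u)) =
      ((D y).map (mfderiv (𝓡 m) (𝓡 n) π y).toLinearMap).map
        (chartDeriv (π p) (π y)).toLinearMap := by
    rintro u hu _ rfl
    have hu' := hmemU u hu
    rw [(hXD _ hu'.2.1).2, Submodule.map_span, Submodule.map_span, ← Set.range_comp,
      ← Set.range_comp]
    congr 2
    ext1 j
    exact fderiv_coordMap_coordField p (π p) (X j) hu.1 (hπd _) hu'.1.2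
  have hfinal := eventually_span_fderiv_eq (h := coordMap p (π p) π)
    (X := fun j ↦ coordField p (X j)) (Z := fun a ↦ coordField p (Z a)) (c := fun t ↦ φ (c t))
    (t₀ := t₀) hΩ hpΩ (contDiffOn_coordMap p (π p) hπ.smooth.contMDiffOn fun y hy ↦ hy.1.2)
    (fun j ↦ contDiffOn_coordField p hU (hXU j)) (fun a ↦ contDiffOn_coordField p hU (hZU a))
    (linearIndependent_coordField hpΩ.1 (hXD _ (hmemU _ hpΩ).2.1).1)
    (linearIndependent_coordField hpΩ.1 (hZC _ (hmemU _ hpΩ).2.2).1) ?_ ?_ ?_ ?_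
  · filter_upwards [hfinal, hcU] with t ht htU
    have h1 := himage _ (mem_chartImage htU.1.1 htU) (c t) (φ.left_inv htU.1.1)
    have h2 := himage _ hpΩ p (φ.left_inv hpφ)
    refine sigma_eq_of_map_chartDeriv_eq (π p) _ _ ?_ (mem_extChartAt_source (π p)) ?_
    · exact (hπ.fiber_eq _ _).2 (sameLeaf_of_tangent hc hcC t t₀)
    · exact h1.symm.trans (ht.trans h2)
  · intro a u hu
    have hu' := hmemU u hu
    rw [fderiv_coordMap_coordField p (π p) (Z a) hu.1 (hπd _) hu'.1.2]
    have h1 : Z a (φ.symm u) ∈ C (φ.symm u) := by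
      rw [(hZC _ hu'.2.2).2]
      exact Submodule.subset_span ⟨a, rfl⟩
    rw [← hπ.ker_eq] at h1
    exact (congrArg _ (LinearMap.mem_ker.1 h1)).trans (map_zero _)
  · intro a j u hu
    have hu' := hmemU u hu
    rw [lieBracket_coordField p hU (hZU a) (hXU j) hu]
    refine coordField_mem_span ?_
    have h1 := hCD U (Z a) (X j) hU (hZU a) (hXU j) (fun y hy ↦ by
        rw [(hZC _ hy.2.2).2]
        exact Submodule.subset_span ⟨a, rfl⟩) (fun y hy ↦ by
        rw [(hXD _ hy.2.1).2]
        exact Submodule.subset_span ⟨j, rfl⟩) _ hu'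
    rw [(hXD _ hu'.2.1).2] at h1
    exact h1
  · exact ((hφd p hpφ).comp t₀ hc.contMDiffAt).contDiffAt
  · filter_upwards [hcU] with t ht
    have h1 : HasDerivAt (fun t ↦ φ (c t)) (chartDeriv p (c t)
        (mfderiv 𝓘(ℝ, ℝ) (𝓡 m) c t (1 : ℝ))) t := by
      have h2 := (((hφd _ ht.1.1).mdifferentiableAt (by simp)).hasMFDerivAt.comp t
        (hc.mdifferentiableAt (by simp)).hasMFDerivAt)
      have h3 : HasFDerivAt (fun t ↦ φ (c t)) (chartDeriv p (c t) ∘L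
        mfderiv 𝓘(ℝ, ℝ) (𝓡 m) c t : ℝ →L[ℝ] EuclideanSpace ℝ (Fin m)) t := h2.hasFDerivAt
      exact h3.hasDerivAt
    rw [h1.deriv]
    have h4 := hcC t
    rw [(hZC _ ht.2.2).2] at h4
    have h5 := Submodule.mem_map_of_mem (f := (chartDeriv p (c t)).toLinearMap) h4
    rw [Submodule.map_span, ← Set.range_comp] at h5
    have h6 : ∀ a, coordField p (Z a) (φ (c t)) = chartDeriv p (c t) (Z a (c t)) := by
      intro a
      have h7 : φ.symm (φ (c t)) = c t := φ.left_inv ht.1.1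
      change chartDeriv p (φ.symm (φ (c t))) (Z a (φ.symm (φ (c t)))) = _
      rw [h7]
    simp_rw [h6]
    exact h5

/-- If `[C, D] ⊆ D`, then `π_* D` takes the same value at all points of a leaf of `C`. -/
theorem mapAt_eq_of_leafSpace {C D : SubspaceField m M} (hC : IsDistribution C)
    (hD : IsDistribution D) (hCD : BracketLE C D D) {π : M → S}
    (hπ : IsLeafSpace (n := n) C π) {x y : M} (hxy : π x = π y) :
    mapAt (n := n) π x (D x) = mapAt (n := n) π y (D y) := by
  have h := (hπ.fiber_eq x y).1 hxy
  clear hxy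
  induction h with
  | refl => rfl
  | tail _ hbc ih =>
    obtain ⟨c, hc, rfl, rfl, hcC⟩ := hbc
    rw [ih]
    have hloc : IsLocallyConstant fun t ↦ mapAt (n := n) π (c t) (D (c t)) :=
      (IsLocallyConstant.iff_eventually_eq _).2 fun t ↦ eventually_mapAt_eq hC hD hCD hπ hc hcC t
    exact hloc.apply_eq_of_preconnectedSpace 0 1

/-- The supremum defining the push-forward of a distribution invariant under `C` has equal
terms. -/
theorem pushforward_apply {C D : SubspaceField m M} (hC : IsDistribution C)
    (hD : IsDistribution D) (hCD : BracketLE C D D) {π : M → S}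
    (hπ : IsLeafSpace (n := n) C π) (x : M) :
    pushforward (n := n) D π (π x) = (D x).map (mfderiv (𝓡 m) (𝓡 n) π x).toLinearMap := by
  have key : ∀ (y : M) (h : π y = π x), (h ▸ (D y).map (mfderiv (𝓡 m) (𝓡 n) π y).toLinearMap :
      Submodule ℝ (TangentSpace (𝓡 n) (π x))) =
      (D x).map (mfderiv (𝓡 m) (𝓡 n) π x).toLinearMap := by
    intro y h
    exact eqRec_eq_of_sigma_eq h _ _ (mapAt_eq_of_leafSpace hC hD hCD hπ h)
  refine le_antisymm (iSup₂_le fun y h ↦ (key y h).le) ?_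
  exact le_iSup₂_of_le (f := fun (y : M) (h : π y = π x) ↦
    (h ▸ (D y).map (mfderiv (𝓡 m) (𝓡 n) π y).toLinearMap :
      Submodule ℝ (TangentSpace (𝓡 n) (π x)))) x rfl le_rfl

end LeafSpace

/-! ### Push-forward of flags by local diffeomorphisms -/

section PartialDiffeo

variable {n : ℕ} {S : Type*} [TopologicalSpace S] [ChartedSpace (EuclideanSpace ℝ (Fin n)) S]
  {n₁ : ℕ} {S₁ : Type*} [TopologicalSpace S₁] [ChartedSpace (EuclideanSpace ℝ (Fin n₁)) S₁]

/-- A homeomorphism between open subsets is a diffeomorphism. -/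
structure IsPartialDiffeo (ψ : OpenPartialHomeomorph S S₁) : Prop where
  smooth : ContMDiffOn (𝓡 n) (𝓡 n₁) ∞ ψ ψ.source
  smooth_symm : ContMDiffOn (𝓡 n₁) (𝓡 n) ∞ ψ.symm ψ.target

variable {ψ : OpenPartialHomeomorph S S₁}

theorem IsPartialDiffeo.symm (h : IsPartialDiffeo (n := n) (n₁ := n₁) ψ) :
    IsPartialDiffeo (n := n₁) (n₁ := n) ψ.symm :=
  ⟨h.smooth_symm, by simpa using h.smooth⟩

theorem IsPartialDiffeo.contMDiffAt (h : IsPartialDiffeo (n := n) (n₁ := n₁) ψ) {γ : S}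
    (hγ : γ ∈ ψ.source) : ContMDiffAt (𝓡 n) (𝓡 n₁) ∞ ψ γ :=
  h.smooth.contMDiffAt (ψ.open_source.mem_nhds hγ)

theorem IsPartialDiffeo.mdifferentiableAt (h : IsPartialDiffeo (n := n) (n₁ := n₁) ψ) {γ : S}
    (hγ : γ ∈ ψ.source) : MDifferentiableAt (𝓡 n) (𝓡 n₁) ψ γ :=
  (h.contMDiffAt hγ).mdifferentiableAt (by simp)

theorem IsPartialDiffeo.push_symm_push (h : IsPartialDiffeo (n := n) (n₁ := n₁) ψ)
    {Λ : FlagBundle n S} (hΛ : Λ.base ∈ ψ.source) :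
    (Λ.push (n₁ := n₁) ψ).push (n₁ := n) ψ.symm = Λ := by
  rw [FlagBundle.push_push (h.symm.mdifferentiableAt (ψ.map_source hΛ)) (h.mdifferentiableAt hΛ)]
  refine Eq.trans (FlagBundle.push_congr ?_) Λ.push_id
  filter_upwards [ψ.open_source.mem_nhds hΛ] with γ hγ
  exact ψ.left_inv hγ

theorem isOpen_source_inter_preimage_extChartAt_source (ψ : OpenPartialHomeomorph S S₁) (γ₁ : S₁) :
    IsOpen (ψ.source ∩ ψ ⁻¹' (extChartAt (𝓡 n₁) γ₁).source) :=
  ψ.continuousOn.isOpen_inter_preimage ψ.open_source (isOpen_extChartAt_source γ₁)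

theorem isPartialDiffeo_refl : IsPartialDiffeo (n := n) (n₁ := n) (OpenPartialHomeomorph.refl S) :=
  ⟨contMDiffOn_id, contMDiffOn_id⟩

theorem isPartialDiffeo_of_diffeomorph (F : S ≃ₘ⟮𝓡 n, 𝓡 n₁⟯ S₁) :
    IsPartialDiffeo (n := n) (n₁ := n₁) F.toHomeomorph.toOpenPartialHomeomorph :=
  ⟨F.contMDiff.contMDiffOn, F.symm.contMDiff.contMDiffOn⟩

/-- Push-forward of a subspace by the inverse of a diffeomorphism inverts the push-forward by the
diffeomorphism. -/
theorem IsPartialDiffeo.exists_map_mfderiv_eq {ψ : OpenPartialHomeomorph S S₁}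
    (h : IsPartialDiffeo (n := n) (n₁ := n₁) ψ) {y : S} (hy : y ∈ ψ.source)
    (W : Submodule ℝ (TangentSpace (𝓡 n₁) (ψ y))) :
    ∃ W' : Submodule ℝ (TangentSpace (𝓡 n) y), W'.map (mfderiv (𝓡 n) (𝓡 n₁) ψ y).toLinearMap = W ∧
      mapAt (n := n) ψ.symm (ψ y) W = ⟨y, W'⟩ := by
  have hid : ψ ∘ ψ.symm =ᶠ[𝓝 (ψ y)] id := by
    filter_upwards [ψ.open_target.mem_nhds (ψ.map_source hy)] with z hz
    exact ψ.right_inv hz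
  have hd := h.symm.mdifferentiableAt (ψ.map_source hy)
  have hyy : ψ.symm (ψ y) = y := ψ.left_inv hy
  have h1 := mapAt_comp (x := ψ y) (f := ψ.symm) (g := ψ) (by
    rw [hyy]; exact h.mdifferentiableAt hy) hd W
  rw [mapAt_congr hid, mapAt_id] at h1
  obtain ⟨W', hW'⟩ : ∃ W' : Submodule ℝ (TangentSpace (𝓡 n) y),
      mapAt (n := n) ψ.symm (ψ y) W = ⟨y, W'⟩ := by
    have : (mapAt (n := n) ψ.symm (ψ y) W).1 = y := hyy
    generalize mapAt (n := n) ψ.symm (ψ y) W = a at this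
    obtain ⟨γ, W'⟩ := a
    obtain rfl : γ = y := this
    exact ⟨W', rfl⟩
  refine ⟨W', ?_, hW'⟩
  have h2 : ∀ a b : Σ γ : S, Submodule ℝ (TangentSpace (𝓡 n) γ), a = b →
      mapAt (n := n₁) ψ a.1 a.2 = mapAt (n := n₁) ψ b.1 b.2 := by
    rintro a _ rfl
    rfl
  have h3 := h1.trans (h2 _ _ hW')
  exact (eq_of_heq (Sigma.mk.inj h3).2).symm

theorem IsPartialDiffeo.map_mfderiv_symm_eq {C : SubspaceField n S} {C₁ : SubspaceField n₁ S₁}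
    {F : OpenPartialHomeomorph S S₁} (hF : IsPartialDiffeo (n := n) (n₁ := n₁) F)
    (hC : ∀ y ∈ F.source, (C y).map (mfderiv (𝓡 n) (𝓡 n₁) F y).toLinearMap = C₁ (F y))
    {z : S₁} (hz : z ∈ F.target) :
    (C₁ z).map (mfderiv (𝓡 n₁) (𝓡 n) F.symm z).toLinearMap = C (F.symm z) := by
  obtain ⟨y, hy, rfl⟩ : ∃ y ∈ F.source, F y = z := ⟨F.symm z, F.map_target hz, F.right_inv hz⟩
  have hid : F.symm ∘ F =ᶠ[𝓝 y] id := by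
    filter_upwards [F.open_source.mem_nhds hy] with w hw using F.left_inv hw
  have h1 := (mapAt_comp (hF.symm.mdifferentiableAt hz) (hF.mdifferentiableAt hy) (C y)).symm.trans
    ((mapAt_congr hid _).trans (mapAt_id y (C y)))
  rw [hC y hy] at h1
  have h2 : (⟨F.symm (F y), C (F.symm (F y))⟩ : Σ γ : S, Submodule ℝ (TangentSpace (𝓡 n) γ)) =
      ⟨y, C y⟩ := by rw [F.left_inv hy]
  exact eq_of_heq (Sigma.mk.inj (h1.trans h2.symm)).2

variable [IsManifold (𝓡 n) ∞ S] [IsManifold (𝓡 n₁) ∞ S₁]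

theorem IsPartialDiffeo.contDiffOn_coordMap (h : IsPartialDiffeo (n := n) (n₁ := n₁) ψ)
    (γ₀ : S) (γ₁ : S₁) :
    ContDiffOn ℝ ∞ (coordMap (m := n) (n := n₁) γ₀ γ₁ ψ)
      (chartImage γ₀ (ψ.source ∩ ψ ⁻¹' (extChartAt (𝓡 n₁) γ₁).source)) :=
  FlagLin.contDiffOn_coordMap γ₀ γ₁ (h.smooth.mono Set.inter_subset_left) fun _ hx ↦ hx.2

theorem IsPartialDiffeo.fderiv_coordMap_symm_comp (h : IsPartialDiffeo (n := n) (n₁ := n₁) ψ)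
    {γ₀ γ : S} {γ₁ : S₁} (hγ : γ ∈ ψ.source) (hγ₀ : γ ∈ (extChartAt (𝓡 n) γ₀).source)
    (hγ₁ : ψ γ ∈ (extChartAt (𝓡 n₁) γ₁).source) :
    fderiv ℝ (coordMap (m := n₁) (n := n) γ₁ γ₀ ψ.symm) (extChartAt (𝓡 n₁) γ₁ (ψ γ)) ∘L
      fderiv ℝ (coordMap (m := n) (n := n₁) γ₀ γ₁ ψ) (extChartAt (𝓡 n) γ₀ γ) =
        ContinuousLinearMap.id ℝ (EuclideanSpace ℝ (Fin n)) := by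
  set φ := extChartAt (𝓡 n) γ₀
  set χ := extChartAt (𝓡 n₁) γ₁
  have hu : φ γ ∈ chartImage (m := n) γ₀ (ψ.source ∩ ψ ⁻¹' χ.source) :=
    mem_chartImage hγ₀ ⟨hγ, hγ₁⟩
  have hv : χ (ψ γ) ∈ chartImage (m := n₁) γ₁ (ψ.symm.source ∩ ψ.symm ⁻¹' φ.source) :=
    mem_chartImage hγ₁ ⟨ψ.map_source hγ, by rwa [Set.mem_preimage, ψ.left_inv hγ]⟩
  have hΩ := isOpen_chartImage (m := n) γ₀ (isOpen_source_inter_preimage_extChartAt_source (n₁ := n₁) ψ γ₁)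
  have hΩ₁ := isOpen_chartImage (m := n₁) γ₁ (isOpen_source_inter_preimage_extChartAt_source (n₁ := n) ψ.symm γ₀)
  have h1 := (((h.contDiffOn_coordMap γ₀ γ₁).contDiffAt (hΩ.mem_nhds hu)).differentiableAt
    (by simp)).hasFDerivAt
  have h2 := (((h.symm.contDiffOn_coordMap γ₁ γ₀).contDiffAt (hΩ₁.mem_nhds hv)).differentiableAt
    (by simp)).hasFDerivAt
  have hval : ∀ u ∈ chartImage (m := n) γ₀ (ψ.source ∩ ψ ⁻¹' χ.source),
      coordMap (m := n₁) (n := n) γ₁ γ₀ ψ.symm (coordMap (m := n) (n := n₁) γ₀ γ₁ ψ u) = u := by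
    intro u hu
    change φ (ψ.symm (χ.symm (χ (ψ (φ.symm u))))) = u
    rw [χ.left_inv hu.2.2, ψ.left_inv hu.2.1, φ.right_inv hu.1]
  have hγv : coordMap (m := n) (n := n₁) γ₀ γ₁ ψ (φ γ) = χ (ψ γ) := by
    change χ (ψ (φ.symm (φ γ))) = _
    rw [φ.left_inv hγ₀]
  rw [← hγv] at h2 ⊢
  refine (h2.comp (φ γ) h1).unique ((hasFDerivAt_id (φ γ)).congr_of_eventuallyEq ?_)
  filter_upwards [hΩ.mem_nhds hu] with u hu
  exact hval u hu

variable {m : ℕ} {M : Type*} [TopologicalSpace M] [ChartedSpace (EuclideanSpace ℝ (Fin m)) M]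

/-- Push-forward by a diffeomorphism preserves smoothness of a family of flags, also when another
chart is used for the image. -/
theorem IsPartialDiffeo.contMDiffAt_proj_push (h : IsPartialDiffeo (n := n) (n₁ := n₁) ψ)
    {f : M → FlagBundle n S} {x : M} {γ₁ : S₁} {i : ℤ}
    (hb : ContMDiffAt (𝓡 m) (𝓡 n) ∞ (fun y ↦ (f y).base) x)
    (hp : ContMDiffAt (𝓡 m) 𝓘(ℝ, EuclideanSpace ℝ (Fin n) →L[ℝ] EuclideanSpace ℝ (Fin n)) ∞
      (fun y ↦ (f y).proj (f x).base i) x)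
    (hx : (f x).base ∈ ψ.source) (hx₁ : ψ (f x).base ∈ (extChartAt (𝓡 n₁) γ₁).source) :
    ContMDiffAt (𝓡 m) 𝓘(ℝ, EuclideanSpace ℝ (Fin n₁) →L[ℝ] EuclideanSpace ℝ (Fin n₁)) ∞
      (fun y ↦ ((f y).push (n₁ := n₁) ψ).proj γ₁ i) x := by
  set γ₀ := (f x).base with hγ₀
  set φ := extChartAt (𝓡 n) γ₀
  set χ := extChartAt (𝓡 n₁) γ₁
  let U : Set S := φ.source ∩ (ψ.source ∩ ψ ⁻¹' χ.source)
  have hU : IsOpen U :=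
    (isOpen_extChartAt_source γ₀).inter (isOpen_source_inter_preimage_extChartAt_source (n₁ := n₁) ψ γ₁)
  have hxU : γ₀ ∈ U := ⟨mem_extChartAt_source γ₀, hx, hx₁⟩
  have hfU : ∀ᶠ y in 𝓝 x, (f y).base ∈ U := hb.continuousAt.eventually (hU.mem_nhds hxU)
  have hΩ := isOpen_chartImage (m := n) γ₀ (isOpen_source_inter_preimage_extChartAt_source (n₁ := n₁) ψ γ₁)
  have hΩ₁ := isOpen_chartImage (m := n₁) γ₁ (isOpen_source_inter_preimage_extChartAt_source (n₁ := n) ψ.symm γ₀)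
  have hu : φ γ₀ ∈ chartImage (m := n) γ₀ (ψ.source ∩ ψ ⁻¹' χ.source) :=
    mem_chartImage hxU.1 hxU.2
  have hv : χ (ψ γ₀) ∈ chartImage (m := n₁) γ₁ (ψ.symm.source ∩ ψ.symm ⁻¹' φ.source) :=
    mem_chartImage hx₁ ⟨ψ.map_source hx, by
      rw [Set.mem_preimage, ψ.left_inv hx]; exact hxU.1⟩
  have hφb : ContMDiffAt (𝓡 m) 𝓘(ℝ, EuclideanSpace ℝ (Fin n)) ∞ (fun y ↦ φ (f y).base) x :=
    (contMDiffAt_extChartAt (I := 𝓡 n)).comp x hb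
  have hχb : ContMDiffAt (𝓡 m) 𝓘(ℝ, EuclideanSpace ℝ (Fin n₁)) ∞ (fun y ↦ χ (ψ (f y).base)) x :=
    ContMDiffAt.comp x (contMDiffAt_extChartAt' (I := 𝓡 n₁) (by rwa [← extChartAt_source (𝓡 n₁)]))
      ((h.contMDiffAt hx).comp x hb)
  have hA : ContMDiffAt (𝓡 m) 𝓘(ℝ, EuclideanSpace ℝ (Fin n) →L[ℝ] EuclideanSpace ℝ (Fin n₁)) ∞
      (fun y ↦ fderiv ℝ (coordMap (m := n) (n := n₁) γ₀ γ₁ ψ) (φ (f y).base)) x :=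
    ContMDiffAt.comp x (g := fderiv ℝ (coordMap (m := n) (n := n₁) γ₀ γ₁ ψ))
      ((((h.contDiffOn_coordMap γ₀ γ₁).contDiffAt (hΩ.mem_nhds hu)).fderiv_right (m := ∞)
        (by simp)).contMDiffAt) hφb
  have hB : ContMDiffAt (𝓡 m) 𝓘(ℝ, EuclideanSpace ℝ (Fin n₁) →L[ℝ] EuclideanSpace ℝ (Fin n)) ∞
      (fun y ↦ fderiv ℝ (coordMap (m := n₁) (n := n) γ₁ γ₀ ψ.symm) (χ (ψ (f y).base))) x :=
    ContMDiffAt.comp x (g := fderiv ℝ (coordMap (m := n₁) (n := n) γ₁ γ₀ ψ.symm))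
      ((((h.symm.contDiffOn_coordMap γ₁ γ₀).contDiffAt (hΩ₁.mem_nhds hv)).fderiv_right (m := ∞)
        (by simp)).contMDiffAt) hχb
  have key := contMDiffAt_starProjection_map
    (W := fun y ↦ ((f y).flag i).map (chartDeriv γ₀ (f y).base).toLinearMap) hA hB hp ?_ ?_
  · refine key.congr_of_eventuallyEq ?_
    filter_upwards [hfU] with y hy
    have hy' : φ.symm (φ (f y).base) = (f y).base := φ.left_inv hy.1
    have hAy : ∀ v, fderiv ℝ (coordMap (m := n) (n := n₁) γ₀ γ₁ ψ) (φ (f y).base)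
        (chartDeriv γ₀ (f y).base v) =
        chartDeriv γ₁ (ψ (f y).base) (mfderiv (𝓡 n) (𝓡 n₁) ψ (f y).base v) := by
      intro v
      have h1 := fderiv_coordMap γ₀ γ₁ (φ.map_source hy.1)
        (h.mdifferentiableAt (by rw [hy']; exact hy.2.1)) (by rw [hy']; exact hy.2.2)
        (chartDeriv γ₀ (f y).base v)
      have h2 : ∀ γ, γ = (f y).base →
          chartDeriv γ₁ (ψ γ) (mfderiv (𝓡 n) (𝓡 n₁) ψ γ
            (chartSymmDeriv γ₀ γ (chartDeriv γ₀ (f y).base v))) =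
          chartDeriv γ₁ (ψ (f y).base) (mfderiv (𝓡 n) (𝓡 n₁) ψ (f y).base v) := by
        rintro _ rfl
        rw [chartSymmDeriv_chartDeriv hy.1]
      exact h1.trans (h2 _ hy')
    change Submodule.starProjection _ = Submodule.starProjection _
    congr 1
    change Submodule.map _ (Submodule.map _ _) = Submodule.map _ (Submodule.map _ _)
    refine (Submodule.map_comp _ _ _).symm.trans (Eq.trans ?_ (Submodule.map_comp _ _ _))
    congr 1
    ext1 v
    exact (hAy v).symm
  · filter_upwards [hfU] with y hy
    exact h.fderiv_coordMap_symm_comp hy.2.1 hy.1 hy.2.2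
  · filter_upwards [hfU] with y hy
    have h1 := h.symm.fderiv_coordMap_symm_comp (γ₀ := γ₁) (γ₁ := γ₀) (ψ.map_source hy.2.1) hy.2.2
      (by rw [ψ.left_inv hy.2.1]; exact hy.1)
    rw [ψ.symm_symm, ψ.left_inv hy.2.1] at h1
    exact h1

end PartialDiffeo

/-! ### Smoothness of maps into submanifolds of the flag bundle -/

section FlagMaps

variable {m : ℕ} {M : Type*} [TopologicalSpace M] [ChartedSpace (EuclideanSpace ℝ (Fin m)) M]
  {n : ℕ} {S : Type*} [TopologicalSpace S] [ChartedSpace (EuclideanSpace ℝ (Fin n)) S]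
  {X : Type*} [TopologicalSpace X]

/-- Continuity into the flag bundle may be checked on base points and on projections in charts. -/
theorem continuousAt_flagBundle {f : X → FlagBundle n S} {x : X}
    (hb : ContinuousAt (fun y ↦ (f y).base) x)
    (hp : ∀ γ₀ : S, (f x).base ∈ (extChartAt (𝓡 n) γ₀).source → ∀ i,
      ContinuousAt (fun y ↦ (f y).proj γ₀ i) x) : ContinuousAt f x := by
  refine TopologicalSpace.tendsto_nhds_generateFrom_iff.2 ?_
  rintro _ ⟨γ₀, O, hO, rfl⟩ ⟨h1, h2⟩
  have h3 : ContinuousAt (fun y ↦ ((f y).base, (f y).proj γ₀)) x :=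
    hb.prodMk (continuousAt_pi.2 fun i ↦ hp γ₀ (by rwa [extChartAt_source]) i)
  filter_upwards [hb.eventually ((chartAt _ γ₀).open_source.mem_nhds h1),
    h3.eventually (hO.mem_nhds h2)] with y hy1 hy2
  exact ⟨hy1, hy2⟩

theorem FlagBundle.continuous_base : Continuous (FlagBundle.base : FlagBundle n S → S) := by
  refine continuous_def.2 fun W hW ↦ ?_
  have : (FlagBundle.base : FlagBundle n S → S) ⁻¹' W = ⋃ γ₀ : S,
      {Λ : FlagBundle n S | Λ.base ∈ (chartAt (EuclideanSpace ℝ (Fin n)) γ₀).source ∧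
        (Λ.base, Λ.proj γ₀) ∈ W ×ˢ Set.univ} := by
    ext Λ
    simp only [Set.mem_preimage, Set.mem_iUnion, Set.mem_ofPred_eq, Set.mem_prod, Set.mem_univ,
      and_true]
    exact ⟨fun h ↦ ⟨Λ.base, mem_chart_source _ _, h⟩, fun ⟨_, _, h⟩ ↦ h⟩
  rw [this]
  exact isOpen_iUnion fun γ₀ ↦ TopologicalSpace.isOpen_generateFrom_of_mem
    ⟨γ₀, _, hW.prod isOpen_univ, rfl⟩

/-- Finitely many members of the flags suffice to detect the tangent vectors at a given point, as
intersections of subspaces of the finite-dimensional tangent space become stationary. -/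
theorem IsFlagEmbedding.exists_finset {f : M → FlagBundle n S}
    (hf : IsFlagEmbedding (m := m) f) (x : M) :
    ∃ s : Finset ℤ, ∀ v : TangentSpace (𝓡 m) x,
      mfderiv (𝓡 m) (𝓡 n) (fun y ↦ (f y).base) x v = 0 →
      (∀ i ∈ s, mfderiv (𝓡 m) 𝓘(ℝ, EuclideanSpace ℝ (Fin n) →L[ℝ] EuclideanSpace ℝ (Fin n))
        (fun y ↦ (f y).proj (f x).base i) x v = 0) → v = 0 := by
  let K : ℤ → Submodule ℝ (EuclideanSpace ℝ (Fin m)) := fun i ↦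
    (mfderiv (𝓡 m) 𝓘(ℝ, EuclideanSpace ℝ (Fin n) →L[ℝ] EuclideanSpace ℝ (Fin n))
      (fun y ↦ (f y).proj (f x).base i) x).toLinearMap.ker
  obtain ⟨s, hs⟩ := Finset.exists_inf_le K
  refine ⟨s, fun v hv hvs ↦ hf.immersion x v hv fun i ↦ ?_⟩
  have h1 : (show EuclideanSpace ℝ (Fin m) from v) ∈ s.inf K :=
    (Submodule.mem_finsetInf (x := show EuclideanSpace ℝ (Fin m) from v)).2 fun j hj ↦ hvs j hj
  exact hs i h1

variable [IsManifold (𝓡 n) ∞ S]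

/-- Smoothness of a family of flags may be read off in any chart. -/
theorem IsFlagEmbedding.contMDiffAt_proj {f : M → FlagBundle n S}
    (hf : IsFlagEmbedding (m := m) f) {γ₀ : S} {x : M} (i : ℤ)
    (hx : (f x).base ∈ (extChartAt (𝓡 n) γ₀).source) :
    ContMDiffAt (𝓡 m) 𝓘(ℝ, EuclideanSpace ℝ (Fin n) →L[ℝ] EuclideanSpace ℝ (Fin n)) ∞
      (fun y ↦ (f y).proj γ₀ i) x := by
  -- push-forward by the identity changes the chart
  have h := isPartialDiffeo_refl.contMDiffAt_proj_push (γ₁ := γ₀) (i := i)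
    hf.smooth_base.contMDiffAt (hf.smooth_proj x i) (Set.mem_univ _) hx
  refine h.congr_of_eventuallyEq (Filter.Eventually.of_forall fun y ↦ ?_)
  exact (congrArg (fun Λ : FlagBundle n S ↦ Λ.proj γ₀ i) (f y).push_id).symm

variable [IsManifold (𝓡 m) ∞ M]

/-- Near each of its points, an embedding into the flag bundle is inverted by a smooth function of the
base point and of finitely many projections. -/
theorem IsFlagEmbedding.exists_smooth_leftInverse {f : M → FlagBundle n S}
    (hf : IsFlagEmbedding (m := m) f) (x : M) :
    ∃ (s : Finset ℤ) (ρ : EuclideanSpace ℝ (Fin n) ×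
        (s → EuclideanSpace ℝ (Fin n) →L[ℝ] EuclideanSpace ℝ (Fin n)) →
        EuclideanSpace ℝ (Fin m)),
      ContDiffAt ℝ ∞ ρ (extChartAt (𝓡 n) (f x).base (f x).base,
        fun i ↦ (f x).proj (f x).base i) ∧
      ∀ᶠ y in 𝓝 x, ρ (extChartAt (𝓡 n) (f x).base (f y).base,
        fun i ↦ (f y).proj (f x).base i) = extChartAt (𝓡 m) x y := by
  obtain ⟨s, hs⟩ := hf.exists_finset x
  set γ := (f x).base with hγ
  let φ := extChartAt (𝓡 m) x
  let χ := extChartAt (𝓡 n) γ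
  let π : M → S := fun y ↦ (f y).base
  have hπ : ContMDiff (𝓡 m) (𝓡 n) ∞ π := hf.smooth_base
  let U : Set M := π ⁻¹' χ.source
  have hU : IsOpen U := (isOpen_extChartAt_source γ).preimage hπ.continuous
  have hxφ : x ∈ φ.source := mem_extChartAt_source x
  have hφx : φ.symm (φ x) = x := φ.left_inv hxφ
  have hxU : x ∈ U := mem_extChartAt_source γ
  have hΩ := isOpen_chartImage (m := m) x hU
  have hxΩ : φ x ∈ chartImage (m := m) x U := mem_chartImage hxφ hxU
  let p : ℤ → EuclideanSpace ℝ (Fin m) → EuclideanSpace ℝ (Fin n) →L[ℝ] EuclideanSpace ℝ (Fin n) :=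
    fun i u ↦ (f (φ.symm u)).proj γ i
  let h : EuclideanSpace ℝ (Fin m) → EuclideanSpace ℝ (Fin n) ×
      (s → EuclideanSpace ℝ (Fin n) →L[ℝ] EuclideanSpace ℝ (Fin n)) :=
    fun u ↦ (coordMap x γ π u, fun i ↦ p i u)
  have hp : ∀ i, ContDiffOn ℝ ∞ (p i) (chartImage x U) := fun i u hu ↦ by
    refine ContDiffAt.contDiffWithinAt (ContMDiffAt.contDiffAt ?_)
    exact ContMDiffAt.comp u (hf.contMDiffAt_proj i hu.2)
      ((contMDiffOn_extChartAt_symm x).contMDiffAt ((isOpen_extChartAt_target x).mem_nhds hu.1))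
  have hc : ContDiffOn ℝ ∞ (coordMap x γ π) (chartImage x U) :=
    contDiffOn_coordMap x γ hπ.contMDiffOn fun y hy ↦ hy
  have hh : ContDiffOn ℝ ∞ h (chartImage x U) := hc.prodMk (contDiffOn_pi.2 fun i ↦ hp i)
  have hinj : Function.Injective (fderiv ℝ h (φ x)) := by
    refine (injective_iff_map_eq_zero _).2 fun v hv ↦ ?_
    have hcd := ((hc.contDiffAt (hΩ.mem_nhds hxΩ)).differentiableAt (by simp)).hasFDerivAt
    have hpd := fun i ↦ (((hp i).contDiffAt (hΩ.mem_nhds hxΩ)).differentiableAt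
      (by simp)).hasFDerivAt
    have hd : HasFDerivAt h ((fderiv ℝ (coordMap x γ π) (φ x)).prod
        (ContinuousLinearMap.pi fun i : s ↦ fderiv ℝ (p i) (φ x))) (φ x) :=
      hcd.prodMk (hasFDerivAt_pi.2 fun i ↦ hpd i)
    rw [hd.fderiv] at hv
    have h1 : fderiv ℝ (coordMap x γ π) (φ x) v = 0 := congrArg Prod.fst hv
    have h2 : ∀ i : s, fderiv ℝ (p i) (φ x) v = 0 := fun i ↦ congrFun (congrArg Prod.snd hv) i
    have h3 : ∀ y, φ.symm (φ x) = y → mfderiv (𝓡 m) (𝓡 n) π y (chartSymmDeriv x y v) = 0 := by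
      rintro _ rfl
      rw [fderiv_coordMap x γ hxΩ.1 (hπ.mdifferentiableAt (by simp)) hxΩ.2] at h1
      exact chartDeriv_injective hxΩ.2 (h1.trans (map_zero _).symm)
    have h4 : ∀ i ∈ s, ∀ y, φ.symm (φ x) = y →
        mfderiv (𝓡 m) 𝓘(ℝ, EuclideanSpace ℝ (Fin n) →L[ℝ] EuclideanSpace ℝ (Fin n))
          (fun y ↦ (f y).proj γ i) y (chartSymmDeriv x y v) = 0 := by
      rintro i hi _ rfl
      have h5 := ((hf.contMDiffAt_proj i hxΩ.2).mdifferentiableAt (by simp)).hasMFDerivAt.comp (φ x)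
        (mdifferentiableAt_extChartAt_symm x hxΩ.1).hasMFDerivAt
      rw [mfderiv_extChartAt_symm x hxΩ.1] at h5
      have h6 : HasFDerivAt (p i) (_ : EuclideanSpace ℝ (Fin m) →L[ℝ] _) (φ x) := h5.hasFDerivAt
      have h7 := h2 ⟨i, hi⟩
      rw [h6.fderiv] at h7
      exact h7
    have h8 := hs (chartSymmDeriv x x v) (h3 x hφx) fun i hi ↦ h4 i hi x hφx
    rw [← chartDeriv_chartSymmDeriv hxφ v]
    exact (congrArg _ h8).trans (map_zero _)
  obtain ⟨ρ, hρ, hρh⟩ := exists_leftInverse_of_injective_fderiv hΩ hxΩ hh hinj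
  have hhφ : ∀ y ∈ φ.source, h (φ y) = (χ (f y).base, fun i : s ↦ (f y).proj γ i) := by
    intro y hy
    have h9 : φ.symm (φ y) = y := φ.left_inv hy
    change (χ (f (φ.symm (φ y))).base, fun i : s ↦ (f (φ.symm (φ y))).proj γ i) = _
    rw [h9]
  refine ⟨s, ρ, ?_, ?_⟩
  · rw [hhφ x hxφ] at hρ
    exact hρ
  · filter_upwards [(continuousAt_extChartAt (I := 𝓡 m) x).eventually hρh,
      extChartAt_source_mem_nhds (I := 𝓡 m) x] with y hy1 hy2
    rw [← hhφ y hy2]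
    exact hy1

/-- A map into a manifold embedded into a flag bundle is smooth if its composition with the
embedding is. -/
theorem IsFlagEmbedding.contMDiffAt_of_comp {f : M → FlagBundle n S}
    (hf : IsFlagEmbedding (m := m) f) {k : ℕ} {N : Type*} [TopologicalSpace N]
    [ChartedSpace (EuclideanSpace ℝ (Fin k)) N] {F : N → M} {g : N → FlagBundle n S} {x : N}
    (hg : ∀ᶠ y in 𝓝 x, f (F y) = g y)
    (hb : ContMDiffAt (𝓡 k) (𝓡 n) ∞ (fun y ↦ (g y).base) x)
    (hp : ∀ γ₀ : S, (g x).base ∈ (extChartAt (𝓡 n) γ₀).source → ∀ i,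
      ContMDiffAt (𝓡 k) 𝓘(ℝ, EuclideanSpace ℝ (Fin n) →L[ℝ] EuclideanSpace ℝ (Fin n)) ∞
        (fun y ↦ (g y).proj γ₀ i) x) :
    ContMDiffAt (𝓡 k) (𝓡 m) ∞ F x := by
  have hgx := hg.self_of_nhds
  have hcont : ContinuousAt F x := by
    rw [hf.isEmbedding.isInducing.continuousAt_iff]
    refine ContinuousAt.congr (f := g) ?_ (hg.mono fun y hy ↦ hy.symm)
    exact continuousAt_flagBundle hb.continuousAt fun γ₀ h i ↦ (hp γ₀ h i).continuousAt
  obtain ⟨s, ρ, hρ, hρf⟩ := hf.exists_smooth_leftInverse (F x)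
  set γ := (f (F x)).base
  have hγ : (g x).base = γ := by rw [← hgx]
  have hγs : (g x).base ∈ (extChartAt (𝓡 n) γ).source := by
    rw [hγ]; exact mem_extChartAt_source γ
  have h1 : ContMDiffAt (𝓡 k) 𝓘(ℝ, EuclideanSpace ℝ (Fin n) ×
      (s → EuclideanSpace ℝ (Fin n) →L[ℝ] EuclideanSpace ℝ (Fin n))) ∞
      (fun y ↦ (extChartAt (𝓡 n) γ (g y).base, fun i : s ↦ (g y).proj γ i)) x := by
    refine ContMDiffAt.prodMk_space ?_ (contMDiffAt_pi_space.2 fun i ↦ hp γ hγs i)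
    exact ContMDiffAt.comp x
      (contMDiffAt_extChartAt' (I := 𝓡 n) (by rwa [← extChartAt_source (𝓡 n)])) hb
  have h2 : ContMDiffAt (𝓡 k) 𝓘(ℝ, EuclideanSpace ℝ (Fin m)) ∞ (fun y ↦ ρ
      (extChartAt (𝓡 n) γ (g y).base, fun i : s ↦ (g y).proj γ i)) x := by
    refine ContMDiffAt.comp x (g := ρ) ?_ h1
    rw [← hgx]
    exact hρ.contMDiffAt
  have h3 : (fun y ↦ ρ (extChartAt (𝓡 n) γ (g y).base, fun i : s ↦ (g y).proj γ i)) =ᶠ[𝓝 x]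
      fun y ↦ extChartAt (𝓡 m) (F x) (F y) := by
    filter_upwards [hg, hcont.eventually hρf] with y hy1 hy2
    rw [← hy1]
    exact hy2
  have h4 := h2.congr_of_eventuallyEq h3.symm
  have h5 : ContMDiffAt (𝓡 k) (𝓡 m) ∞
      (fun y ↦ (extChartAt (𝓡 m) (F x)).symm (extChartAt (𝓡 m) (F x) (F y))) x :=
    ContMDiffAt.comp x ((contMDiffOn_extChartAt_symm (F x)).contMDiffAt
      ((isOpen_extChartAt_target (F x)).mem_nhds (mem_extChartAt_target (F x)))) h4
  refine h5.congr_of_eventuallyEq ?_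
  filter_upwards [hcont.eventually (extChartAt_source_mem_nhds (I := 𝓡 m) (F x))] with y hy
  exact ((extChartAt (𝓡 m) (F x)).left_inv hy).symm

end FlagMaps

/-! ### Equivalences of tuples and of their linearizations -/

section Equivalence

/-- A subspace containing the kernel is determined by its image. -/
theorem eq_of_map_eq_of_ker_le {E F : Type*} [AddCommGroup E] [Module ℝ E] [AddCommGroup F]
    [Module ℝ F] (A : E →ₗ[ℝ] F) {V W : Submodule ℝ E} (hV : A.ker ≤ V) (hW : A.ker ≤ W)
    (h : V.map A = W.map A) : V = W := by
  rw [← Submodule.comap_map_eq_self hV, h, Submodule.comap_map_eq_self hW]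

variable {m m₁ n n₁ : ℕ}
  {M : Type*} [TopologicalSpace M] [ChartedSpace (EuclideanSpace ℝ (Fin m)) M]
  {M₁ : Type*} [TopologicalSpace M₁] [ChartedSpace (EuclideanSpace ℝ (Fin m₁)) M₁]
  {S : Type*} [TopologicalSpace S] [ChartedSpace (EuclideanSpace ℝ (Fin n)) S]
  {S₁ : Type*} [TopologicalSpace S₁] [ChartedSpace (EuclideanSpace ℝ (Fin n₁)) S₁]
  {T : Tuple m M} {T₁ : Tuple m₁ M₁} {π : M → S} {π₁ : M₁ → S₁}

/-- A smooth map carrying `C` onto `C₁` maps leaves into leaves. -/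
theorem SameLeaf.map {C : SubspaceField m M} {C₁ : SubspaceField m₁ M₁} {F : M → M₁}
    (hF : ContMDiff (𝓡 m) (𝓡 m₁) ∞ F)
    (hC : ∀ y, (C y).map (mfderiv (𝓡 m) (𝓡 m₁) F y).toLinearMap = C₁ (F y)) {x y : M}
    (h : SameLeaf C x y) : SameLeaf C₁ (F x) (F y) := by
  refine Relation.ReflTransGen.lift F ?_ _ _ h
  rintro _ _ ⟨c, hc, rfl, rfl, hcC⟩
  refine ⟨fun t ↦ F (c t), hF.comp hc, rfl, rfl, fun t ↦ ?_⟩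
  have h1 := mfderiv_comp_apply t (hF.mdifferentiableAt (x := c t) (by simp))
    (hc.mdifferentiableAt (x := t) (by simp)) (1 : ℝ)
  have h2 : mfderiv (𝓡 m) (𝓡 m₁) F (c t) (mfderiv 𝓘(ℝ, ℝ) (𝓡 m) c t (1 : ℝ)) ∈ C₁ (F (c t)) := by
    rw [← hC]
    exact Submodule.mem_map_of_mem (hcC t)
  exact h1.symm ▸ h2

/-- A smooth map of the leaf spaces that lifts to `F` carries flags to flags. -/
theorem push_linearization_eq {F : M → M₁} {ψ : S → S₁} {y : M}
    (hπ : MDifferentiableAt (𝓡 m) (𝓡 n) π y)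
    (hπ₁ : MDifferentiableAt (𝓡 m₁) (𝓡 n₁) π₁ (F y))
    (hψ : MDifferentiableAt (𝓡 n) (𝓡 n₁) ψ (π y)) (hF : MDifferentiableAt (𝓡 m) (𝓡 m₁) F y)
    (hcomm : ∀ᶠ z in 𝓝 y, ψ (π z) = π₁ (F z))
    (hV : ∀ i, (T.V i y).map (mfderiv (𝓡 m) (𝓡 m₁) F y).toLinearMap = T₁.V i (F y)) :
    (T.linearization (n := n) π y).push (n₁ := n₁) ψ = T₁.linearization (n := n₁) π₁ (F y) := by
  refine FlagBundle.eq_of_sigma_eq hcomm.self_of_nhds fun i ↦ ?_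
  have h1 := (mapAt_comp hψ hπ (T.V i y)).symm.trans
    ((mapAt_congr (f := ψ ∘ π) (g := π₁ ∘ F) hcomm _).trans (mapAt_comp hπ₁ hF (T.V i y)))
  rw [hV i] at h1
  exact h1

/-- A smooth map over a smooth map of the leaf spaces maps `C = ker dπ` into `C₁ = ker dπ₁`. -/
theorem map_C_le {F : M → M₁} {ψ : S → S₁} {y : M} (hπ : IsLeafSpace (n := n) T.C π)
    (hπ₁ : IsLeafSpace (n := n₁) T₁.C π₁)
    (hψ : MDifferentiableAt (𝓡 n) (𝓡 n₁) ψ (π y)) (hF : MDifferentiableAt (𝓡 m) (𝓡 m₁) F y)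
    (hcomm : ∀ᶠ z in 𝓝 y, ψ (π z) = π₁ (F z)) :
    (T.C y).map (mfderiv (𝓡 m) (𝓡 m₁) F y).toLinearMap ≤ T₁.C (F y) := by
  have hπd := hπ.smooth.mdifferentiableAt (x := y) (by simp)
  have hπ₁d := hπ₁.smooth.mdifferentiableAt (x := F y) (by simp)
  have h1 := (mapAt_comp hψ hπd (T.C y)).symm.trans
    ((mapAt_congr (f := ψ ∘ π) (g := π₁ ∘ F) hcomm _).trans (mapAt_comp hπ₁d hF (T.C y)))
  have h2 : (T.C y).map (mfderiv (𝓡 m) (𝓡 n) π y).toLinearMap = ⊥ := by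
    rw [← hπ.ker_eq]
    exact LinearMap.le_ker_iff_map.1 le_rfl
  rw [h2] at h1
  rw [← hπ₁.ker_eq, LinearMap.le_ker_iff_map]
  have h3 : mapAt (m := n) (n := n₁) ψ (π y) ⊥ = ⟨π₁ (F y), ⊥⟩ :=
    sigma_mk_eq hcomm.self_of_nhds _ _ (Submodule.map_bot _)
  exact (eq_of_heq (Sigma.mk.inj (h3.symm.trans h1)).2).symm

theorem map_C_eq {F : OpenPartialHomeomorph M M₁} (hF : IsPartialDiffeo (n := m) (n₁ := m₁) F)
    {ψ : OpenPartialHomeomorph S S₁} (hψ : IsPartialDiffeo (n := n) (n₁ := n₁) ψ)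
    (hπ : IsLeafSpace (n := n) T.C π) (hπ₁ : IsLeafSpace (n := n₁) T₁.C π₁)
    (hsource : ∀ y ∈ F.source, π y ∈ ψ.source) (hcomm : ∀ y ∈ F.source, ψ (π y) = π₁ (F y))
    {y : M} (hy : y ∈ F.source) :
    (T.C y).map (mfderiv (𝓡 m) (𝓡 m₁) F y).toLinearMap = T₁.C (F y) := by
  have hcomm' : ∀ z ∈ F.target, ψ.symm (π₁ z) = π (F.symm z) := by
    intro z hz
    have h1 := F.map_target hz
    have h2 := hcomm _ h1
    rw [F.right_inv hz] at h2
    rw [← h2, ψ.left_inv (hsource _ h1)]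
  have hy₁ := F.map_source hy
  have hψt : π₁ (F y) ∈ ψ.target := by
    rw [← hcomm y hy]
    exact ψ.map_source (hsource y hy)
  refine le_antisymm (map_C_le hπ hπ₁ (hψ.mdifferentiableAt (hsource y hy))
    (hF.mdifferentiableAt hy) ?_) ?_
  · filter_upwards [F.open_source.mem_nhds hy] with z hz using hcomm z hz
  · have h1 := map_C_le (F := F.symm) (ψ := ψ.symm) (y := F y) hπ₁ hπ
      (hψ.symm.mdifferentiableAt hψt) (hF.symm.mdifferentiableAt hy₁) (by
        filter_upwards [F.open_target.mem_nhds hy₁] with z hz using hcomm' z hz)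
    obtain ⟨W', hW', hW''⟩ := hF.exists_map_mfderiv_eq hy (T₁.C (F y))
    have h2 : ∀ a b : Σ γ : M, Submodule ℝ (TangentSpace (𝓡 m) γ), a = b → a.2 ≤ T.C a.1 →
        b.2 ≤ T.C b.1 := by
      rintro a _ rfl h
      exact h
    have h3 : W' ≤ T.C y := h2 _ _ hW'' h1
    rw [← hW']
    exact Submodule.map_mono h3

variable [IsManifold (𝓡 n) ∞ S] [IsManifold (𝓡 n₁) ∞ S₁]

/-- Maps that lift a local diffeomorphism of the leaf spaces to the submanifolds of flags are
smooth. -/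
theorem contMDiffOn_of_push_eq [IsManifold (𝓡 m₁) ∞ M₁] {F : M → M₁} {A : Set M} (hA : IsOpen A)
    {ψ : OpenPartialHomeomorph S S₁} (hψ : IsPartialDiffeo (n := n) (n₁ := n₁) ψ)
    (hY : IsFlagEmbedding (m := m) (T.linearization (n := n) π))
    (hY₁ : IsFlagEmbedding (m := m₁) (T₁.linearization (n := n₁) π₁))
    (hsource : ∀ y ∈ A, π y ∈ ψ.source)
    (hpush : ∀ y ∈ A, T₁.linearization (n := n₁) π₁ (F y) =
      (T.linearization (n := n) π y).push (n₁ := n₁) ψ) :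
    ContMDiffOn (𝓡 m) (𝓡 m₁) ∞ F A := by
  intro x hx
  refine (hY₁.contMDiffAt_of_comp
    (g := fun y ↦ (T.linearization (n := n) π y).push (n₁ := n₁) ψ)
    (Filter.mem_of_superset (hA.mem_nhds hx) hpush) ?_ fun γ₁ hγ₁ i ↦ ?_).contMDiffWithinAt
  · exact (hψ.contMDiffAt (hsource x hx)).comp x hY.smooth_base.contMDiffAt
  · exact hψ.contMDiffAt_proj_push hY.smooth_base.contMDiffAt (hY.smooth_proj x i)
      (hsource x hx) hγ₁

variable [IsManifold (𝓡 m) ∞ M]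

theorem IsLeafSpace.isOpenMap {C : SubspaceField m M} (hπ : IsLeafSpace (n := n) C π) :
    IsOpenMap π := by
  intro U hU
  refine isOpen_iff_mem_nhds.2 ?_
  rintro _ ⟨x, hx, rfl⟩
  obtain ⟨V, -, -, hxV, hVU, hV, -, -⟩ := exists_factor_of_ker_mfderiv_le hπ.smooth
    (hπ.submersion x) hU hx hπ.smooth.contMDiffOn fun _ _ _ h ↦ h
  exact Filter.mem_of_superset (hV.mem_nhds ⟨x, hxV, rfl⟩) (Set.image_mono hVU)

/-- A local equivalence of tuples descends locally to the leaf spaces. -/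
theorem exists_descent {F : M → M₁} {U : Set M} (hU : IsOpen U)
    (hF : ContMDiffOn (𝓡 m) (𝓡 m₁) ∞ F U) (hπ : IsLeafSpace (n := n) T.C π)
    (hπ₁ : IsLeafSpace (n := n₁) T₁.C π₁)
    (hC : ∀ y ∈ U, (T.C y).map (mfderiv (𝓡 m) (𝓡 m₁) F y).toLinearMap = T₁.C (F y))
    {x : M} (hx : x ∈ U) :
    ∃ (V : Set M) (g : S → S₁), IsOpen V ∧ x ∈ V ∧ V ⊆ U ∧ IsOpen (π '' V) ∧
      ContMDiffOn (𝓡 n) (𝓡 n₁) ∞ g (π '' V) ∧ ∀ y ∈ V, π₁ (F y) = g (π y) := by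
  refine exists_factor_of_ker_mfderiv_le (f := fun y ↦ π₁ (F y)) hπ.smooth (hπ.submersion x) hU hx
    (hπ₁.smooth.comp_contMDiffOn hF) fun y hy v hv ↦ ?_
  have h1 : v ∈ T.C y := by
    rw [← hπ.ker_eq]
    exact hv
  have h2 : mfderiv (𝓡 m) (𝓡 m₁) F y v ∈ T₁.C (F y) := by
    rw [← hC y hy]
    exact Submodule.mem_map_of_mem h1
  rw [← hπ₁.ker_eq] at h2
  have h3 := mfderiv_comp_apply y (hπ₁.smooth.mdifferentiableAt (x := F y) (by simp))
    ((hF.contMDiffAt (hU.mem_nhds hy)).mdifferentiableAt (by simp)) v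
  exact h3.trans h2

/-- A smooth map carrying `C` onto `C₁` descends to the leaf spaces: it maps leaves into leaves, and the
induced map is smooth because it is so locally. -/
theorem exists_global_descent {F : M → M₁} (hF : ContMDiff (𝓡 m) (𝓡 m₁) ∞ F)
    (hπ : IsLeafSpace (n := n) T.C π) (hπ₁ : IsLeafSpace (n := n₁) T₁.C π₁)
    (hC : ∀ y, (T.C y).map (mfderiv (𝓡 m) (𝓡 m₁) F y).toLinearMap = T₁.C (F y)) :
    ∃ ψ : S → S₁, ContMDiff (𝓡 n) (𝓡 n₁) ∞ ψ ∧ ∀ y, ψ (π y) = π₁ (F y) := by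
  have hψ : ∀ y, π₁ (F (Function.surjInv hπ.surjective (π y))) = π₁ (F y) := fun y ↦
    (hπ₁.fiber_eq _ _).2 (((hπ.fiber_eq _ _).1 (Function.surjInv_eq hπ.surjective (π y))).map hF hC)
  refine ⟨fun γ ↦ π₁ (F (Function.surjInv hπ.surjective γ)), fun γ ↦ ?_, hψ⟩
  obtain ⟨x, rfl⟩ := hπ.surjective γ
  obtain ⟨V, g, -, hxV, -, hVo, hg, hgV⟩ := exists_descent isOpen_univ hF.contMDiffOn hπ hπ₁
    (fun y _ ↦ hC y) (Set.mem_univ x)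
  have hn := hVo.mem_nhds ⟨x, hxV, rfl⟩
  refine (hg.contMDiffAt hn).congr_of_eventuallyEq ?_
  filter_upwards [hn]
  rintro _ ⟨y, hy, rfl⟩
  exact (hψ y).trans (hgV y hy)

variable [IsManifold (𝓡 m₁) ∞ M₁]

/-- A smooth map of the leaf spaces that lifts to `F` carries `π_* Δ̃` to `π₁_* Δ̃₁`. -/
theorem map_pushforward_eq {F : M → M₁} {ψ : S → S₁} {y : M} (hT : T.IsAdmissible)
    (hT₁ : T₁.IsAdmissible) (hπ : IsLeafSpace (n := n) T.C π)
    (hπ₁ : IsLeafSpace (n := n₁) T₁.C π₁)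
    (hψ : MDifferentiableAt (𝓡 n) (𝓡 n₁) ψ (π y)) (hF : MDifferentiableAt (𝓡 m) (𝓡 m₁) F y)
    (hcomm : ∀ᶠ z in 𝓝 y, ψ (π z) = π₁ (F z))
    (hD : (T.Delta y).map (mfderiv (𝓡 m) (𝓡 m₁) F y).toLinearMap = T₁.Delta (F y)) :
    (pushforward (n := n) T.Delta π (π y)).map (mfderiv (𝓡 n) (𝓡 n₁) ψ (π y)).toLinearMap =
      pushforward (n := n₁) T₁.Delta π₁ (ψ (π y)) := by
  have hπd := hπ.smooth.mdifferentiableAt (x := y) (by simp)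
  have hπ₁d := hπ₁.smooth.mdifferentiableAt (x := F y) (by simp)
  have h1 := (mapAt_comp hψ hπd (T.Delta y)).symm.trans
    ((mapAt_congr (f := ψ ∘ π) (g := π₁ ∘ F) hcomm _).trans (mapAt_comp hπ₁d hF (T.Delta y)))
  rw [hD] at h1
  rw [pushforward_apply hT.isDistribution_C hT.isDistribution_Delta hT.symm hπ y]
  have h2 : (⟨ψ (π y), pushforward (n := n₁) T₁.Delta π₁ (ψ (π y))⟩ :
      Σ γ : S₁, Submodule ℝ (TangentSpace (𝓡 n₁) γ)) = mapAt π₁ (F y) (T₁.Delta (F y)) := by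
    rw [hcomm.self_of_nhds,
      pushforward_apply hT₁.isDistribution_C hT₁.isDistribution_Delta hT₁.symm hπ₁ (F y)]
    rfl
  exact eq_of_heq (Sigma.mk.inj (h1.trans h2.symm)).2

/-- A local diffeomorphism compatible with the flags and with `Δ` is an equivalence of tuples:
each member of the tuple contains `C` and is therefore the preimage of its image. -/
theorem mapsOnto_of_push_eq {F : OpenPartialHomeomorph M M₁}
    (hF : IsPartialDiffeo (n := m) (n₁ := m₁) F)
    {ψ : OpenPartialHomeomorph S S₁} (hψ : IsPartialDiffeo (n := n) (n₁ := n₁) ψ)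
    (hT : T.IsAdmissible) (hT₁ : T₁.IsAdmissible)
    (hC : ∀ i x, T.C x ≤ T.V i x) (hC₁ : ∀ i x, T₁.C x ≤ T₁.V i x)
    (hπ : IsLeafSpace (n := n) T.C π) (hπ₁ : IsLeafSpace (n := n₁) T₁.C π₁)
    (hsource : ∀ y ∈ F.source, π y ∈ ψ.source)
    (hpush : ∀ y ∈ F.source, T₁.linearization (n := n₁) π₁ (F y) =
      (T.linearization (n := n) π y).push (n₁ := n₁) ψ)
    (hD : ∀ γ ∈ ψ.source, (pushforward (n := n) T.Delta π γ).map
      (mfderiv (𝓡 n) (𝓡 n₁) ψ γ).toLinearMap = pushforward (n := n₁) T₁.Delta π₁ (ψ γ))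
    {y : M} (hy : y ∈ F.source) :
    T.MapsOnto T₁ y (F y) (mfderiv (𝓡 m) (𝓡 m₁) F y) := by
  have hcomm : ∀ y ∈ F.source, ψ (π y) = π₁ (F y) := fun y hy ↦
    (congrArg FlagBundle.base (hpush y hy)).symm
  have hCC := map_C_eq hF hψ hπ hπ₁ hsource hcomm hy
  have hcomm' : ψ ∘ π =ᶠ[𝓝 y] π₁ ∘ F := by
    filter_upwards [F.open_source.mem_nhds hy] with z hz using hcomm z hz
  have hψd := hψ.mdifferentiableAt (hsource y hy)
  have hFd := hF.mdifferentiableAt hy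
  have hπd := hπ.smooth.mdifferentiableAt (x := y) (by simp)
  have hπ₁d := hπ₁.smooth.mdifferentiableAt (x := F y) (by simp)
  have key : ∀ (V : Submodule ℝ (TangentSpace (𝓡 m) y))
      (V₁ : Submodule ℝ (TangentSpace (𝓡 m₁) (F y))), T.C y ≤ V → T₁.C (F y) ≤ V₁ →
      mapAt (n := n₁) π₁ (F y) V₁ =
        mapAt (n := n₁) ψ (π y) (V.map (mfderiv (𝓡 m) (𝓡 n) π y).toLinearMap) →
      V.map (mfderiv (𝓡 m) (𝓡 m₁) F y).toLinearMap = V₁ := by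
    intro V V₁ hV hV₁ h
    have h1 := h.trans ((mapAt_comp hψd hπd V).symm.trans
      ((mapAt_congr hcomm' V).trans (mapAt_comp hπ₁d hFd V)))
    have h2 := eq_of_heq (Sigma.mk.inj h1).2
    refine eq_of_map_eq_of_ker_le (mfderiv (𝓡 m₁) (𝓡 n₁) π₁ (F y)).toLinearMap ?_ ?_ h2.symm
    · rw [hπ₁.ker_eq, ← hCC]
      exact Submodule.map_mono hV
    · rwa [hπ₁.ker_eq]
  refine ⟨?_, hCC, fun i ↦ ?_⟩
  · refine key _ _ (hT.C_le y) (hT₁.C_le _) ?_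
    have h1 := hD _ (hsource y hy)
    rw [pushforward_apply hT.isDistribution_C hT.isDistribution_Delta hT.symm hπ y] at h1
    have h2 : (⟨ψ (π y), pushforward (n := n₁) T₁.Delta π₁ (ψ (π y))⟩ :
        Σ γ : S₁, Submodule ℝ (TangentSpace (𝓡 n₁) γ)) = mapAt π₁ (F y) (T₁.Delta (F y)) := by
      rw [hcomm y hy,
        pushforward_apply hT₁.isDistribution_C hT₁.isDistribution_Delta hT₁.symm hπ₁ (F y)]
      rfl
    rw [← h2, ← h1]
    rfl
  · exact key _ _ (hC i y) (hC₁ i _) (FlagBundle.sigma_eq (hpush y hy) i)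

/-- A diffeomorphism carrying one tuple onto the other maps leaves to leaves; the induced
diffeomorphism of the leaf spaces is an equivalence of the flag structures. -/
theorem flagStructure_equivalent (hT : T.IsAdmissible) (hT₁ : T₁.IsAdmissible)
    (hπ : IsLeafSpace (n := n) T.C π) (hπ₁ : IsLeafSpace (n := n₁) T₁.C π₁)
    (h : T.Equivalent T₁) :
    (T.flagStructure (n := n) π).Equivalent (T₁.flagStructure (n := n₁) π₁) := by
  obtain ⟨F, hF⟩ := h
  obtain ⟨ψ, hψ, hψF⟩ := exists_global_descent F.contMDiff hπ hπ₁ fun y ↦ (hF y).C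
  obtain ⟨χ, hχ, hχF⟩ := exists_global_descent F.symm.contMDiff hπ₁ hπ fun z ↦
    IsPartialDiffeo.map_mfderiv_symm_eq (isPartialDiffeo_of_diffeomorph F) (fun y _ ↦ (hF y).C) (Set.mem_univ z)
  have hl : Function.LeftInverse χ ψ := by
    intro γ
    obtain ⟨y, rfl⟩ := hπ.surjective γ
    rw [hψF, hχF, F.symm_apply_apply]
  have hr : Function.RightInverse χ ψ := by
    intro γ
    obtain ⟨y, rfl⟩ := hπ₁.surjective γ
    rw [hχF, hψF, F.apply_symm_apply]
  have hpush : ∀ y, (T.linearization (n := n) π y).push (n₁ := n₁) ψ =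
      T₁.linearization (n := n₁) π₁ (F y) := fun y ↦
    push_linearization_eq (hπ.smooth.mdifferentiableAt (by simp))
      (hπ₁.smooth.mdifferentiableAt (by simp)) (hψ.mdifferentiableAt (by simp))
      (F.contMDiff.mdifferentiableAt (by simp)) (Filter.Eventually.of_forall hψF) (hF y).V
  refine ⟨⟨⟨ψ, χ, hl, hr⟩, hψ, hχ⟩, fun γ ↦ ?_, ?_⟩
  · obtain ⟨y, rfl⟩ := hπ.surjective γ
    exact map_pushforward_eq hT hT₁ hπ hπ₁ (hψ.mdifferentiableAt (by simp))
      (F.contMDiff.mdifferentiableAt (by simp)) (Filter.Eventually.of_forall hψF) (hF y).Delta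
  · refine (Set.range_comp _ _).symm.trans (Set.Subset.antisymm ?_ ?_)
    · rintro _ ⟨y, rfl⟩
      exact ⟨F y, (hpush y).symm⟩
    · rintro _ ⟨z, rfl⟩
      refine ⟨F.symm z, (hpush _).trans ?_⟩
      rw [F.apply_symm_apply]

/-- An equivalence of flag structures maps the set of flags of the one onto that of the other;
identifying points with their flags, this is an equivalence of the tuples. -/
theorem equivalent_of_flagStructure (hT : T.IsAdmissible) (hT₁ : T₁.IsAdmissible)
    (hC : ∀ i x, T.C x ≤ T.V i x) (hC₁ : ∀ i x, T₁.C x ≤ T₁.V i x)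
    (hπ : IsLeafSpace (n := n) T.C π) (hπ₁ : IsLeafSpace (n := n₁) T₁.C π₁)
    (hY : IsFlagEmbedding (m := m) (T.linearization (n := n) π))
    (hY₁ : IsFlagEmbedding (m := m₁) (T₁.linearization (n := n₁) π₁))
    (h : (T.flagStructure (n := n) π).Equivalent (T₁.flagStructure (n := n₁) π₁)) :
    T.Equivalent T₁ := by
  obtain ⟨ψ, hD, hpushY⟩ := h
  have hψ := isPartialDiffeo_of_diffeomorph ψ
  have hex : ∀ y, ∃ z, T₁.linearization (n := n₁) π₁ z =
      (T.linearization (n := n) π y).push (n₁ := n₁) ψ := by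
    intro y
    have h1 : (T.linearization (n := n) π y).push (n₁ := n₁) ψ ∈
        (T₁.flagStructure (n := n₁) π₁).Y := hpushY ▸ ⟨_, ⟨y, rfl⟩, rfl⟩
    exact h1
  have hex₁ : ∀ z, ∃ y, T.linearization (n := n) π y =
      (T₁.linearization (n := n₁) π₁ z).push (n₁ := n) ψ.symm := by
    intro z
    have h1 : T₁.linearization (n := n₁) π₁ z ∈ (T₁.flagStructure (n := n₁) π₁).Y := ⟨z, rfl⟩
    rw [← hpushY] at h1
    obtain ⟨_, ⟨y, rfl⟩, h2⟩ := h1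
    exact ⟨y, h2 ▸ (hψ.push_symm_push (Set.mem_univ _)).symm⟩
  choose F hF using hex
  choose G hG using hex₁
  have hl : Function.LeftInverse G F := fun y ↦ hY.isEmbedding.injective <| by
    rw [hG, hF]
    exact hψ.push_symm_push (Set.mem_univ _)
  have hr : Function.RightInverse G F := fun z ↦ hY₁.isEmbedding.injective <| by
    rw [hF, hG]
    exact hψ.symm.push_symm_push (Set.mem_univ _)
  let F' : M ≃ₘ⟮𝓡 m, 𝓡 m₁⟯ M₁ := ⟨⟨F, G, hl, hr⟩,
    contMDiffOn_univ.1 (contMDiffOn_of_push_eq isOpen_univ hψ hY hY₁ (fun _ _ ↦ Set.mem_univ _)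
      fun y _ ↦ hF y),
    contMDiffOn_univ.1 (contMDiffOn_of_push_eq isOpen_univ hψ.symm hY₁ hY
      (fun _ _ ↦ Set.mem_univ _) fun y _ ↦ hG y)⟩
  exact ⟨F', fun y ↦ mapsOnto_of_push_eq (isPartialDiffeo_of_diffeomorph F') hψ hT hT₁ hC hC₁
    hπ hπ₁ (fun _ _ ↦ Set.mem_univ _) (fun y _ ↦ hF y) (fun γ _ ↦ hD γ) (Set.mem_univ y)⟩

/-- Local version of `flagStructure_equivalent`: the descents of `F` and of `F.symm` are defined
locally, and are inverse to each other after shrinking. -/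
theorem flagStructure_locallyEquivalentAt (hT : T.IsAdmissible) (hT₁ : T₁.IsAdmissible)
    (hπ : IsLeafSpace (n := n) T.C π) (hπ₁ : IsLeafSpace (n := n₁) T₁.C π₁)
    (hY : IsFlagEmbedding (m := m) (T.linearization (n := n) π))
    (hY₁ : IsFlagEmbedding (m := m₁) (T₁.linearization (n := n₁) π₁)) {x : M} {x₁ : M₁}
    (h : T.LocallyEquivalentAt T₁ x x₁) :
    (T.flagStructure (n := n) π).LocallyEquivalentAt (T₁.flagStructure (n := n₁) π₁)
      (T.linearization π x) (T₁.linearization π₁ x₁) := by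
  obtain ⟨F, hFs, hFs', hx, rfl, hF⟩ := h
  have hFd : IsPartialDiffeo (n := m) (n₁ := m₁) F := ⟨hFs, hFs'⟩
  obtain ⟨V, g, hV, hxV, hVs, -, hg, hgV⟩ := exists_descent F.open_source hFs hπ hπ₁
    (fun y hy ↦ (hF y hy).C) hx
  obtain ⟨V₁, g₁, hV₁, hxV₁, hVs₁, -, hg₁, hgV₁⟩ := exists_descent F.open_target hFs' hπ₁ hπ
    (fun z hz ↦ IsPartialDiffeo.map_mfderiv_symm_eq hFd (fun y hy ↦ (hF y hy).C) hz) (F.map_source hx)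
  -- `W` and `W₁` correspond to each other under `F`, and both descents are defined there
  let W : Set M := V ∩ F ⁻¹' V₁
  let W₁ : Set M₁ := V₁ ∩ F.symm ⁻¹' V
  have hW : IsOpen W := (F.continuousOn.mono hVs).isOpen_inter_preimage hV hV₁
  have hW₁ : IsOpen W₁ := (F.symm.continuousOn.mono hVs₁).isOpen_inter_preimage hV₁ hV
  have hFW : ∀ y ∈ W, F y ∈ W₁ := fun y hy ↦ ⟨hy.2, by
    rw [Set.mem_preimage, F.left_inv (hVs hy.1)]; exact hy.1⟩
  have hFW₁ : ∀ z ∈ W₁, F.symm z ∈ W := fun z hz ↦ ⟨hz.2, by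
    rw [Set.mem_preimage, F.right_inv (hVs₁ hz.1)]; exact hz.1⟩
  have hg' : ∀ y ∈ W, g (π y) = π₁ (F y) := fun y hy ↦ (hgV y hy.1).symm
  have hg₁' : ∀ z ∈ W₁, g₁ (π₁ z) = π (F.symm z) := fun z hz ↦ (hgV₁ z hz.1).symm
  have hl : ∀ y ∈ W, g₁ (g (π y)) = π y := fun y hy ↦ by
    rw [hg' y hy, hg₁' _ (hFW y hy), F.left_inv (hVs hy.1)]
  have hr : ∀ z ∈ W₁, g (g₁ (π₁ z)) = π₁ z := fun z hz ↦ by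
    rw [hg₁' z hz, hg' _ (hFW₁ z hz), F.right_inv (hVs₁ hz.1)]
  have hgs : ContMDiffOn (𝓡 n) (𝓡 n₁) ∞ g (π '' W) :=
    hg.mono (Set.image_mono Set.inter_subset_left)
  have hgs₁ : ContMDiffOn (𝓡 n₁) (𝓡 n) ∞ g₁ (π₁ '' W₁) :=
    hg₁.mono (Set.image_mono Set.inter_subset_left)
  let ψ : OpenPartialHomeomorph S S₁ :=
    { toFun := g
      invFun := g₁
      source := π '' W
      target := π₁ '' W₁
      map_source' := by
        rintro _ ⟨y, hy, rfl⟩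
        exact ⟨F y, hFW y hy, (hg' y hy).symm⟩
      map_target' := by
        rintro _ ⟨z, hz, rfl⟩
        exact ⟨F.symm z, hFW₁ z hz, (hg₁' z hz).symm⟩
      left_inv' := by
        rintro _ ⟨y, hy, rfl⟩
        exact hl y hy
      right_inv' := by
        rintro _ ⟨z, hz, rfl⟩
        exact hr z hz
      open_source := hπ.isOpenMap _ hW
      open_target := hπ₁.isOpenMap _ hW₁
      continuousOn_toFun := hgs.continuousOn
      continuousOn_invFun := hgs₁.continuousOn }
  have hψ : IsPartialDiffeo (n := n) (n₁ := n₁) ψ := ⟨hgs, hgs₁⟩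
  have hsource : ∀ y ∈ W, π y ∈ ψ.source := fun y hy ↦ ⟨y, hy, rfl⟩
  have hcomm : ∀ y ∈ W, ∀ᶠ z in 𝓝 y, ψ (π z) = π₁ (F z) := fun y hy ↦ by
    filter_upwards [hW.mem_nhds hy] with z hz using hg' z hz
  have hxW : x ∈ W := ⟨hxV, hxV₁⟩
  have hpush : ∀ y ∈ W, (T.linearization (n := n) π y).push (n₁ := n₁) ψ =
      T₁.linearization (n := n₁) π₁ (F y) := fun y hy ↦
    push_linearization_eq (hπ.smooth.mdifferentiableAt (by simp))
      (hπ₁.smooth.mdifferentiableAt (by simp)) (hψ.mdifferentiableAt (hsource y hy))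
      (hFd.mdifferentiableAt (hVs hy.1)) (hcomm y hy) (hF y (hVs hy.1)).V
  obtain ⟨O, hO, hOW⟩ := hY.isEmbedding.isInducing.isOpen_iff.1 hW
  obtain ⟨O₁, hO₁, hOW₁⟩ := hY₁.isEmbedding.isInducing.isOpen_iff.1 hW₁
  have hmem : ∀ y, T.linearization (n := n) π y ∈ O ↔ y ∈ W := fun y ↦ by rw [← hOW]; rfl
  have hmem₁ : ∀ z, T₁.linearization (n := n₁) π₁ z ∈ O₁ ↔ z ∈ W₁ := fun z ↦ by rw [← hOW₁]; rfl
  refine ⟨ψ, hψ.smooth, hψ.smooth_symm, hsource x hxW, hpush x hxW, ?_,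
    O ∩ FlagBundle.base ⁻¹' ψ.source, O₁,
    hO.inter (ψ.open_source.preimage FlagBundle.continuous_base), hO₁,
    ⟨(hmem x).2 hxW, hsource x hxW⟩, (hmem₁ _).2 (hFW x hxW), fun Θ hΘ ↦ hΘ.2, ?_⟩
  · rintro _ ⟨y, hy, rfl⟩
    exact map_pushforward_eq hT hT₁ hπ hπ₁ (hψ.mdifferentiableAt (hsource y hy))
      (hFd.mdifferentiableAt (hVs hy.1)) (hcomm y hy) (hF y (hVs hy.1)).Delta
  · refine Set.Subset.antisymm ?_ ?_
    · rintro _ ⟨_, ⟨⟨y, rfl⟩, hyO, -⟩, rfl⟩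
      have hy := (hmem y).1 hyO
      rw [hpush y hy]
      exact ⟨⟨F y, rfl⟩, (hmem₁ _).2 (hFW y hy)⟩
    · rintro _ ⟨⟨z, rfl⟩, hzO⟩
      have hz := (hmem₁ z).1 hzO
      have hy := hFW₁ z hz
      refine ⟨_, ⟨⟨F.symm z, rfl⟩, (hmem _).2 hy, hsource _ hy⟩, (hpush _ hy).trans ?_⟩
      rw [F.right_inv (hVs₁ hz.1)]

/-- Local version of `equivalent_of_flagStructure`. -/
theorem locallyEquivalentAt_of_flagStructure (hT : T.IsAdmissible) (hT₁ : T₁.IsAdmissible)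
    (hC : ∀ i x, T.C x ≤ T.V i x) (hC₁ : ∀ i x, T₁.C x ≤ T₁.V i x)
    (hπ : IsLeafSpace (n := n) T.C π) (hπ₁ : IsLeafSpace (n := n₁) T₁.C π₁)
    (hY : IsFlagEmbedding (m := m) (T.linearization (n := n) π))
    (hY₁ : IsFlagEmbedding (m := m₁) (T₁.linearization (n := n₁) π₁)) {x : M} {x₁ : M₁}
    (h : (T.flagStructure (n := n) π).LocallyEquivalentAt (T₁.flagStructure (n := n₁) π₁)
      (T.linearization π x) (T₁.linearization π₁ x₁)) :
    T.LocallyEquivalentAt T₁ x x₁ := by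
  obtain ⟨ψ, hψs, hψs', -, hΛ, hD, O, O₁, hO, hO₁, hxO, hxO₁, hOψ, himage⟩ := h
  have hψ : IsPartialDiffeo (n := n) (n₁ := n₁) ψ := ⟨hψs, hψs'⟩
  let Y := T.linearization (n := n) π
  let Y₁ := T₁.linearization (n := n₁) π₁
  have hex : ∀ y ∈ Y ⁻¹' O, ∃ z, Y₁ z ∈ O₁ ∧ Y₁ z = (Y y).push (n₁ := n₁) ψ := by
    intro y hy
    have h1 : (Y y).push (n₁ := n₁) ψ ∈ (T₁.flagStructure (n := n₁) π₁).Y ∩ O₁ :=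
      himage ▸ ⟨_, ⟨⟨y, rfl⟩, hy⟩, rfl⟩
    obtain ⟨⟨z, hz⟩, h2⟩ := h1
    exact ⟨z, (show Y₁ z = _ from hz) ▸ h2, hz⟩
  have hex₁ : ∀ z ∈ Y₁ ⁻¹' O₁, ∃ y, Y y ∈ O ∧ (Y y).push (n₁ := n₁) ψ = Y₁ z := by
    intro z hz
    have h1 : Y₁ z ∈ (T₁.flagStructure (n := n₁) π₁).Y ∩ O₁ := ⟨⟨z, rfl⟩, hz⟩
    rw [← himage] at h1
    obtain ⟨_, ⟨⟨y, rfl⟩, hy⟩, h2⟩ := h1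
    exact ⟨y, hy, h2⟩
  have : Nonempty M := ⟨x⟩
  have : Nonempty M₁ := ⟨x₁⟩
  choose! F hFO hF using hex
  choose! G hGO hG using hex₁
  have hsource : ∀ y ∈ Y ⁻¹' O, π y ∈ ψ.source := fun y hy ↦ hOψ _ hy
  have hG' : ∀ z ∈ Y₁ ⁻¹' O₁, Y (G z) = (Y₁ z).push (n₁ := n) ψ.symm := fun z hz ↦ by
    rw [← hG z hz]
    exact (hψ.push_symm_push (hsource _ (hGO z hz))).symm
  have htarget : ∀ z ∈ Y₁ ⁻¹' O₁, π₁ z ∈ ψ.target := fun z hz ↦ by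
    have h1 : ψ (π (G z)) = π₁ z := congrArg FlagBundle.base (hG z hz)
    rw [← h1]
    exact ψ.map_source (hsource _ (hGO z hz))
  have hA : IsOpen (Y ⁻¹' O) := hO.preimage hY.isEmbedding.continuous
  have hA₁ : IsOpen (Y₁ ⁻¹' O₁) := hO₁.preimage hY₁.isEmbedding.continuous
  have hFs : ContMDiffOn (𝓡 m) (𝓡 m₁) ∞ F (Y ⁻¹' O) :=
    contMDiffOn_of_push_eq hA hψ hY hY₁ hsource hF
  have hGs : ContMDiffOn (𝓡 m₁) (𝓡 m) ∞ G (Y₁ ⁻¹' O₁) :=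
    contMDiffOn_of_push_eq hA₁ hψ.symm hY₁ hY htarget hG'
  let F' : OpenPartialHomeomorph M M₁ :=
    { toFun := F
      invFun := G
      source := Y ⁻¹' O
      target := Y₁ ⁻¹' O₁
      map_source' := hFO
      map_target' := hGO
      left_inv' := fun y hy ↦ hY.isEmbedding.injective <| by
        refine (hG' _ (hFO y hy)).trans ?_
        rw [hF y hy]
        exact hψ.push_symm_push (hsource y hy)
      right_inv' := fun z hz ↦ hY₁.isEmbedding.injective <|
        (hF _ (hGO z hz)).trans (hG z hz)
      open_source := hA
      open_target := hA₁
      continuousOn_toFun := hFs.continuousOn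
      continuousOn_invFun := hGs.continuousOn }
  refine ⟨F', hFs, hGs, hxO, hY₁.isEmbedding.injective ((hF x hxO).trans hΛ), fun y hy ↦ ?_⟩
  exact mapsOnto_of_push_eq ⟨hFs, hGs⟩ hψ hT hT₁ hC hC₁ hπ hπ₁ hsource hF hD hy

end Equivalence

end FlagLin

theorem proposition3p1
    {m m₁ n n₁ : ℕ}
    {M : Type*} [TopologicalSpace M] [T2Space M] [SecondCountableTopology M]
    [ChartedSpace (EuclideanSpace ℝ (Fin m)) M] [IsManifold (𝓡 m) ∞ M]
    {M₁ : Type*} [TopologicalSpace M₁] [T2Space M₁] [SecondCountableTopology M₁]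
    [ChartedSpace (EuclideanSpace ℝ (Fin m₁)) M₁] [IsManifold (𝓡 m₁) ∞ M₁]
    {S : Type*} [TopologicalSpace S] [T2Space S] [SecondCountableTopology S]
    [ChartedSpace (EuclideanSpace ℝ (Fin n)) S] [IsManifold (𝓡 n) ∞ S]
    {S₁ : Type*} [TopologicalSpace S₁] [T2Space S₁] [SecondCountableTopology S₁]
    [ChartedSpace (EuclideanSpace ℝ (Fin n₁)) S₁] [IsManifold (𝓡 n₁) ∞ S₁]
    -- the two tuples, with (P1)-(P4)
    (T : FlagLin.Tuple m M) (T₁ : FlagLin.Tuple m₁ M₁)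
    (hT : T.IsAdmissible) (hT₁ : T₁.IsAdmissible)
    (hC : ∀ i x, T.C x ≤ T.V i x) (hC₁ : ∀ i x, T₁.C x ≤ T₁.V i x)
    -- the manifolds of leaves
    (π : M → S) (π₁ : M₁ → S₁)
    (hπ : FlagLin.IsLeafSpace (n := n) T.C π) (hπ₁ : FlagLin.IsLeafSpace (n := n₁) T₁.C π₁)
    -- the linearizations form submanifolds of the flag bundles (flag structures), of which the
    -- original manifolds are the tautological bundles
    (hY : FlagLin.IsFlagEmbedding (m := m) (n := n) (T.linearization π))
    (hY₁ : FlagLin.IsFlagEmbedding (m := m₁) (n := n₁) (T₁.linearization π₁)) :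
    (T.Equivalent T₁ ↔
      (T.flagStructure (n := n) π).Equivalent (T₁.flagStructure (n := n₁) π₁)) ∧
    ∀ (x : M) (x₁ : M₁),
      T.LocallyEquivalentAt T₁ x x₁ ↔
        (T.flagStructure (n := n) π).LocallyEquivalentAt (T₁.flagStructure (n := n₁) π₁)
          (T.linearization π x) (T₁.linearization π₁ x₁) := by
  exact ⟨⟨FlagLin.flagStructure_equivalent hT hT₁ hπ hπ₁,
      FlagLin.equivalent_of_flagStructure hT hT₁ hC hC₁ hπ hπ₁ hY hY₁⟩,
    fun _ _ ↦ ⟨FlagLin.flagStructure_locallyEquivalentAt hT hT₁ hπ hπ₁ hY hY₁,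
      FlagLin.locallyEquivalentAt_of_flagStructure hT hT₁ hC hC₁ hπ hπ₁ hY hY₁⟩⟩
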